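/- **Setting and notation.** Let $X\neq\{0\}$ be a complex Banach space. For a Banach space $Y$ let $\ell^2(\mathbb Z,Y)$ carry the norm $(\sum_j\|y_j\|^2)^{1/2}$ and let $Y^b$ carry the norm $(\sum_{j=1}^b\|\xi_j\|^2)^{1/2}$. An operator $B\in L(\ell^2(\mathbb Z,Y))$ has matrix entries $b_{i,j}\in L(Y)$, $i,j\in\mathbb Z$; it is banded with band-width $w$ if $b_{i,j}=0$ for $|i-j|>w$, tridiagonal if it is banded with band-width $1$, and band-dominated if it is in the operator norm closure of the banded operators. For an operator $B$ between Banach spaces let $\nu(B)=\inf_{\|x\|=1}\|Bx\|$, and let $B^*$ be the Banach space adjoint. For $B\in L(Y)$ let $\mathrm{Spec}_0 B=\mathrm{Spec}\,B$ and, for $\varepsilon>0$, $\mathrm{Spec}_\varepsilon B=\{\lambda\in\mathbb C: 1/\|(B-\lambda I)^{-1}\|\le\varepsilon\}$, where $1/\|(B-\lambda I)^{-1}\|:=0$ if $B-\lambda I$ is not invertible. Write $S_n\to S$ (Hausdorff) if all the sets are bounded and non-empty and their Hausdorff distance $d_H(S_n,S)$ tends to $0$. Below, $\mathbb N=\{1,2,\dots\}$.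 Let $n\in\mathbb N$, $k\in\mathbb Z$. Let $E_{n,k}$ be the subspace of $\ell^2(\mathbb Z,Y)$ of sequences supported on $\{k+1,\dots,k+n\}$; in the dual space, which is $\ell^2(\mathbb Z,Y^*)$, the same symbol denotes the functionals that depend on these coordinates only. For $B\in L(\ell^2(\mathbb Z,Y))$ let $B^+_{n,k}:Y^n\to Y^{n+2}$ be the $(n+2)\times n$ matrix formed by rows $k,\dots,k+n+1$ and columns $k+1,\dots,k+n$ of $B$, and let $(B^*)^+_{n,k}:(Y^*)^n\to (Y^*)^{n+2}$ be formed in the same way from the matrix $[b_{j,i}^*]$ of $B^*$. Let $I_n^+$ be the $n\times n$ identity matrix with a zero row added at the top and at the bottom. For a finite non-empty $K_n\subset\mathbb Z$ let $$\mu_n^{\mathrm{fin}}(B)=\min_{k\in K_n}\min\big(\nu(B|_{E_{n,k}}),\nu(B^*|_{E_{n,k}})\big),\qquad \Gamma^{n,\mathrm{fin}}_\varepsilon(B)=\{\lambda\in\mathbb C:\mu^{\mathrm{fin}}_n(B-\lambda I)\le\varepsilon\},$$ and let $\varepsilon''_n(B)=2\big(\sup_i\|b_{i,i+1}\|+\sup_i\|b_{i,i-1}\|\big)\sin\frac{\pi}{2(n+1)}$.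 **Theorem.** Let $A\in L(\ell^2(\mathbb Z,X))$ be band-dominated, with matrix entries $a_{i,j}$ such that $\{a_{i,j}:i,j\in\mathbb Z\}\subset L(X)$ is relatively compact. If $A$ is tridiagonal put $A^{(n)}=A$ for all $n\in\mathbb N$; otherwise let $A^{(n)}$ be the operator with matrix entries $\big(1-\frac{|i-j|}{n+1}\big)^{\mathfrak p}a_{i,j}$ for $|i-j|\le n$ and $0$ for $|i-j|>n$, for some fixed $\mathfrak p\ge0$ such that $\|A-A^{(n)}\|\to0$. Let $\delta_n=\|A-A^{(n)}\|$. Let $w_n\in\mathbb N$ be such that $A^{(n)}$ is banded with band-width $w_n$, and let $A_n=\mathcal I_{w_n}A^{(n)}\mathcal I_{w_n}^{-1}$, where $\mathcal I_b:\ell^2(\mathbb Z,X)\to\ell^2(\mathbb Z,X^b)$ is the isometric isomorphism $x\mapsto\big((x_{bi+1},\dots,x_{b(i+1)})\big)_{i\in\mathbb Z}$. Let $(\eta_n)$ be either a positive null sequence or, in the case that $X$ is finite-dimensional or a Hilbert space, $\eta_n=0$ for all $n$. Then: 1. For every $n\in\mathbb N$ there is a finite set $K_n\subset\mathbb Z$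 such that for every $k\in\mathbb Z$ there is $j\in K_n$ with $$\|(A_n)^+_{n,k}-(A_n)^+_{n,j}\|\le 1/n\quad\text{and}\quad\|((A_n)^*)^+_{n,k}-((A_n)^*)^+_{n,j}\|\le 1/n .\qquad(*)$$ 2. For every $n\in\mathbb N$ and every finite $K_n\subset\mathbb Z$ with the property $(*)$: for all $\lambda\in\mathbb C$, $$\mu_n^{\mathrm{fin}}(A_n-\lambda I)=\min_{j\in K_n}\min\Big(\nu\big((A_n)^+_{n,j}-\lambda I_n^+\big),\ \nu\big(((A_n)^*)^+_{n,j}-\lambda I_n^+\big)\Big),$$ and for all $\varepsilon\ge0$, $$\Gamma^{n,\mathrm{fin}}_\varepsilon(A_n)\subset\mathrm{Spec}_{\varepsilon+\delta_n+\eta_n}A\quad\text{and}\quad \mathrm{Spec}_\varepsilon A\subset\Gamma^{n,\mathrm{fin}}_{\varepsilon+\delta_n+\eta_n+\varepsilon''_n(A_n)+1/n}(A_n).$$ 3. For every choice of finite sets $K_n$, $n\in\mathbb N$, with the property $(*)$, and every $\varepsilon\ge0$, as $n\to\infty$, in the Hausdorff metric, $$\Gamma^{n,\mathrm{fin}}_{\varepsilon+2\delta_n+2\eta_n+\varepsilon''_n(A_n)+1/n}(A_n)\to\mathrm{Spec}_\varepsilon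 A;\quad\text{in particular}\quad \Gamma^{n,\mathrm{fin}}_{\varepsilon''_n(A_n)+2\delta_n+2\eta_n+1/n}(A_n)\to\mathrm{Spec}\,A.$$ -/

import Mathlib

open Set Filter Topology
open scoped ENNReal

noncomputable section

namespace BandDom

/-! ### Lower norms, pseudospectra, Hausdorff convergence -/

section General

variable {V W : Type*} [NormedAddCommGroup V] [NormedSpace ℂ V]
  [NormedAddCommGroup W] [NormedSpace ℂ W]

/-- The lower norm `ν(B) = inf {‖B x‖ : ‖x‖ = 1}`. -/
def lowerNorm (B : V →L[ℂ] W) : ℝ :=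
  sInf ((fun x => ‖B x‖) '' {x : V | ‖x‖ = 1})

/-- The lower norm `ν(B|_Z)` of the restriction of `B` to a subspace `Z`. -/
def lowerNormOn (B : V →L[ℂ] W) (Z : Submodule ℂ V) : ℝ :=
  lowerNorm (B ∘L Z.subtypeL)

/-- The Banach space adjoint `B* : W* → V*`, `f ↦ f ∘ B`. -/
def dual (B : V →L[ℂ] W) : StrongDual ℂ W →L[ℂ] StrongDual ℂ V :=
  B.precomp ℂ

open Classical in
/-- `1 / ‖B⁻¹‖`, with the convention that this is `0` if `B` is not invertible. -/
def recipNormInv (B : V →L[ℂ] V) : ℝ :=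
  if IsUnit B then 1 / ‖Ring.inverse B‖ else 0

/-- `B - λ I`. -/
def subScalar (B : V →L[ℂ] V) (z : ℂ) : V →L[ℂ] V :=
  B - z • ContinuousLinearMap.id ℂ V

/-- The closed `ε`-pseudospectrum, `{λ : 1 / ‖(B - λ I)⁻¹‖ ≤ ε}` for `ε > 0`; for `ε = 0` it is by
convention the spectrum. -/
def pseudospectrum (ε : ℝ) (B : V →L[ℂ] V) : Set ℂ :=
  if ε = 0 then spectrum ℂ B
  else {z : ℂ | recipNormInv (subScalar B z) ≤ ε}

/-- `S n → T` in the Hausdorff metric, where all the sets (for `n = 1, 2, …`) are bounded and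
non-empty. The distance is `ℝ≥0∞`-valued. -/
def HausdorffTendsto (S : ℕ → Set ℂ) (T : Set ℂ) : Prop :=
  (∀ n, 1 ≤ n → Bornology.IsBounded (S n) ∧ (S n).Nonempty) ∧
  Bornology.IsBounded T ∧ T.Nonempty ∧
  Tendsto (fun n => Metric.hausdorffEDist (S n) T) atTop (𝓝 0)

/-- The norm of `V` is that of a Hilbert space: it comes from an inner product (compatible with the
given scalar multiplication). -/
def IsHilbertNorm (V : Type*) [NormedAddCommGroup V] [inst : NormedSpace ℂ V] : Prop :=
  ∃ H : InnerProductSpace ℂ V, H.toNormedSpace = inst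

end General

/-! ### Operators on `ℓ²(ℤ, Y)` and their matrices -/

section Ell

variable {Y : Type*} [NormedAddCommGroup Y] [NormedSpace ℂ Y]

/-- The space `ℓ²(ℤ, Y)`. -/
abbrev Ell (Y : Type*) [NormedAddCommGroup Y] : Type _ := lp (fun _ : ℤ => Y) 2

/-- `L(ℓ²(ℤ, Y))`, the bounded linear operators on `ℓ²(ℤ, Y)`. -/
abbrev Op (Y : Type*) [NormedAddCommGroup Y] [NormedSpace ℂ Y] : Type _ := Ell Y →L[ℂ] Ell Y

/-- The coordinate map `x ↦ x_j`. -/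
def coord (j : ℤ) : Ell Y →L[ℂ] Y :=
  LinearMap.mkContinuous
    { toFun := fun x => x j
      map_add' := fun _ _ => rfl
      map_smul' := fun _ _ => rfl } 1
    (fun x => by rw [one_mul]; exact lp.norm_apply_le_norm two_ne_zero x j)

/-- The embedding of `Y` as the `j`-th coordinate. -/
def embed (j : ℤ) : Y →L[ℂ] Ell Y :=
  lp.singleContinuousLinearMap ℂ (fun _ : ℤ => Y) 2 j

/-- The matrix entry `a_{i,j} ∈ L(Y)` of an operator on `ℓ²(ℤ, Y)`. -/
def entry (B : Op Y) (i j : ℤ) : Y →L[ℂ] Y :=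
  coord i ∘L B ∘L embed j

/-- `B` is banded with band-width `w`. -/
def HasBandwidth (B : Op Y) (w : ℕ) : Prop :=
  ∀ i j : ℤ, (w : ℤ) < |i - j| → entry B i j = 0

/-- `B` is tridiagonal. -/
def IsTridiagonal (B : Op Y) : Prop := HasBandwidth B 1

/-- `BO(ℓ²(ℤ, Y))`, the banded operators. -/
def bandedOps (Y : Type*) [NormedAddCommGroup Y] [NormedSpace ℂ Y] :
    Set (Op Y) :=
  {B | ∃ w : ℕ, HasBandwidth B w}

/-- `BDO(ℓ²(ℤ, Y))`, the band-dominated operators: the operator norm closure of the banded ones. -/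
def bandDominatedOps (Y : Type*) [NormedAddCommGroup Y] [NormedSpace ℂ Y] :
    Set (Op Y) :=
  closure (bandedOps Y)

/-- `r(B) = sup_i ‖a_{i,i+1}‖ + sup_i ‖a_{i,i-1}‖`. -/
def offDiag (B : Op Y) : ℝ :=
  (⨆ i : ℤ, ‖entry B i (i + 1)‖) + ⨆ i : ℤ, ‖entry B i (i - 1)‖

/-- The penalty term `ε''_n(B) = 2 r(B) sin (π / (2 (n + 1)))`. -/
def penalty (n : ℕ) (B : Op Y) : ℝ :=
  2 * offDiag B * Real.sin (Real.pi / (2 * ((n : ℝ) + 1)))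

/-- The projection `P_{n,k}` onto the coordinates `k + 1, …, k + n`. -/
def proj (n : ℕ) (k : ℤ) : Op Y :=
  ∑ j ∈ Finset.Icc (k + 1) (k + n), embed j ∘L coord j

/-- `E_{n,k}`, the range of `P_{n,k}`. -/
def sectionSpace (Y : Type*) [NormedAddCommGroup Y] [NormedSpace ℂ Y] (n : ℕ) (k : ℤ) :
    Submodule ℂ (Ell Y) :=
  LinearMap.range (proj n k : Op Y).toLinearMap

/-- The counterpart of `E_{n,k}` in the dual space: the range of `P_{n,k}*`, i.e. the functionals
that only depend on the coordinates `k + 1, …, k + n`. -/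
def dualSectionSpace (Y : Type*) [NormedAddCommGroup Y] [NormedSpace ℂ Y] (n : ℕ) (k : ℤ) :
    Submodule ℂ (StrongDual ℂ (Ell Y)) :=
  LinearMap.range (dual (proj n k : Op Y)).toLinearMap

/-- `μ_n^fin(B) = min_{k ∈ K} min (ν(B|_{E_{n,k}}), ν(B*|_{E_{n,k}}))`, for a finite non-empty
index set `K`. -/
def muFin (n : ℕ) (K : Finset ℤ) (B : Op Y) : ℝ :=
  ⨅ k : {k : ℤ // k ∈ K},
    min (lowerNormOn B (sectionSpace Y n k)) (lowerNormOn (dual B) (dualSectionSpace Y n k))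

/-- `Γ^{n,fin}_ε(B) = {λ : μ_n^fin(B - λ I) ≤ ε}`. -/
def GammaFin (n : ℕ) (K : Finset ℤ) (ε : ℝ) (B : Op Y) : Set ℂ :=
  {z : ℂ | muFin n K (subScalar B z) ≤ ε}

end Ell

/-! ### Finite operator matrices and one-sided truncations -/

section Finite

variable {Y : Type*} [NormedAddCommGroup Y] [NormedSpace ℂ Y]

/-- `Yᵇ` with the norm `(∑ ‖ξ_j‖²)^{1/2}`. -/
abbrev Pow (Y : Type*) [NormedAddCommGroup Y] (b : ℕ) : Type _ := PiLp 2 (fun _ : Fin b => Y)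

/-- The operator `Yⁿ → Yᵐ` given by an `m × n` matrix of operators on `Y`. -/
def ofEntries {m n : ℕ} (M : Fin m → Fin n → (Y →L[ℂ] Y)) : Pow Y n →L[ℂ] Pow Y m :=
  (PiLp.continuousLinearEquiv 2 ℂ (fun _ : Fin m => Y)).symm.toContinuousLinearMap ∘L
    ContinuousLinearMap.pi
      (fun r => ∑ c, M r c ∘L PiLp.proj (𝕜 := ℂ) 2 (fun _ : Fin n => Y) c)

/-- `B⁺_{n,k}`: the `(n + 2) × n` matrix formed by the rows `k, …, k + n + 1` and the columns
`k + 1, …, k + n` of `B`. -/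
def truncPlus (n : ℕ) (k : ℤ) (B : Op Y) : Pow Y n →L[ℂ] Pow Y (n + 2) :=
  ofEntries fun r c => entry B (k + (r : ℕ)) (k + 1 + (c : ℕ))

/-- `(B*)⁺_{n,k}`: the same rows and columns of the matrix of `B*`, whose `(i, j)` entry is
`a_{j,i}* ∈ L(Y*)`. -/
def truncPlusDual (n : ℕ) (k : ℤ) (B : Op Y) :
    Pow (StrongDual ℂ Y) n →L[ℂ] Pow (StrongDual ℂ Y) (n + 2) :=
  ofEntries fun r c => dual (entry B (k + 1 + (c : ℕ)) (k + (r : ℕ)))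

/-- `I⁺_n`: the `n × n` identity matrix with a zero row added at the top and at the bottom. -/
def idPlus (Y : Type*) [NormedAddCommGroup Y] [NormedSpace ℂ Y] (n : ℕ) :
    Pow Y n →L[ℂ] Pow Y (n + 2) :=
  ofEntries fun r c => if (r : ℕ) = (c : ℕ) + 1 then ContinuousLinearMap.id ℂ Y else 0

/-- `min_{j ∈ K} min (ν(B⁺_{n,j} - λ I⁺_n), ν((B*)⁺_{n,j} - λ I⁺_n))`, for a finite non-empty index
set `K`. -/
def muFinMat (n : ℕ) (K : Finset ℤ) (B : Op Y) (z : ℂ) : ℝ :=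
  ⨅ j : {j : ℤ // j ∈ K},
    min (lowerNorm (truncPlus n j B - z • idPlus Y n))
      (lowerNorm (truncPlusDual n j B - z • idPlus (StrongDual ℂ Y) n))

/-- Every pair `(B⁺_{n,k}, (B*)⁺_{n,k})`, `k ∈ ℤ`, is within `1 / n` of one with index in `K`. -/
def IsNet (n : ℕ) (K : Finset ℤ) (B : Op Y) : Prop :=
  ∀ k : ℤ, ∃ j ∈ K, ‖truncPlus n k B - truncPlus n j B‖ ≤ 1 / (n : ℝ) ∧
    ‖truncPlusDual n k B - truncPlusDual n j B‖ ≤ 1 / (n : ℝ)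

end Finite

/-! ### Regrouping into blocks -/

section Block

variable {X : Type*} [NormedAddCommGroup X] [NormedSpace ℂ X]

/-- The bijection `(i, m) ↦ b i + 1 + m` from `ℤ × {0, …, b - 1}` to `ℤ`. -/
def blockIndex (b : ℕ) [NeZero b] : ℤ × Fin b ≃ ℤ :=
  (Int.divModEquiv b).symm.trans (Equiv.addRight 1)

theorem blockIndex_apply (b : ℕ) [NeZero b] (i : ℤ) (m : Fin b) :
    blockIndex b (i, m) = (b : ℤ) * i + 1 + (m : ℕ) := by
  simp [blockIndex, Int.divModEquiv]
  ring

theorem memℓp_iff_sq {Z : Type*} [NormedAddCommGroup Z] (f : ℤ → Z) :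
    Memℓp f 2 ↔ Summable fun i => ‖f i‖ ^ 2 := by
  rw [memℓp_gen_iff (by norm_num)]
  simp

theorem norm_sq_eq_tsum {Z : Type*} [NormedAddCommGroup Z] (f : Ell Z) :
    ‖f‖ ^ 2 = ∑' i, ‖f i‖ ^ 2 := by
  simpa using lp.norm_rpow_eq_tsum (p := 2) (by norm_num) f

theorem block_norm_sq {Z : Type*} [NormedAddCommGroup Z] {b : ℕ} (v : Fin b → Z) :
    ‖(WithLp.toLp 2 v : Pow Z b)‖ ^ 2 = ∑ m, ‖v m‖ ^ 2 := by
  rw [PiLp.norm_sq_eq_of_L2]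

theorem memℓp_block_iff {Z : Type*} [NormedAddCommGroup Z] (b : ℕ) [NeZero b] (x : ℤ → Z) :
    Memℓp (fun i : ℤ => (WithLp.toLp 2 fun m : Fin b => x (blockIndex b (i, m)) : Pow Z b)) 2 ↔
      Memℓp x 2 := by
  rw [memℓp_iff_sq, memℓp_iff_sq, ← (blockIndex b).summable_iff (f := fun i => ‖x i‖ ^ 2)]
  have h := summable_prod_of_nonneg (f := fun p : ℤ × Fin b => ‖x (blockIndex b p)‖ ^ 2)
    (fun _ => by simp)
  simp only [block_norm_sq]
  simp only [tsum_fintype] at h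
  exact ⟨fun hs => h.2 ⟨fun _ => Summable.of_finite, hs⟩, fun hs => (h.1 hs).2⟩

theorem norm_block {Z : Type*} [NormedAddCommGroup Z] (b : ℕ) [NeZero b] (x : Ell Z)
    (ξ : Ell (Pow Z b)) (h : ∀ i, ξ i = WithLp.toLp 2 fun m => x (blockIndex b (i, m))) :
    ‖ξ‖ = ‖x‖ := by
  have hs : Summable fun p => ‖x (blockIndex b p)‖ ^ 2 :=
    ((blockIndex b).summable_iff (f := fun i => ‖x i‖ ^ 2)).2
      ((memℓp_iff_sq fun i => x i).1 (lp.memℓp x))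
  have h1 : ‖x‖ ^ 2 = ∑' i, ∑ m, ‖x (blockIndex b (i, m))‖ ^ 2 := by
    rw [norm_sq_eq_tsum x, ← (blockIndex b).tsum_eq (fun i => ‖x i‖ ^ 2), hs.tsum_prod]
    exact tsum_congr fun i => tsum_fintype _
  have h2 : ‖ξ‖ ^ 2 = ∑' i, ∑ m, ‖x (blockIndex b (i, m))‖ ^ 2 := by
    rw [norm_sq_eq_tsum ξ]
    exact tsum_congr fun i => by rw [h, block_norm_sq]
  exact (sq_eq_sq₀ (norm_nonneg _) (norm_nonneg _)).1 (h2.trans h1.symm)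

/-- The isometric isomorphism `𝓘_b : ℓ²(ℤ, X) → ℓ²(ℤ, Xᵇ)`, `x ↦ ξ`, with
`ξ_i = (x_{bi+1}, …, x_{b(i+1)})`. -/
def blockIso (X : Type*) [NormedAddCommGroup X] [NormedSpace ℂ X] (b : ℕ) [NeZero b] :
    Ell X ≃ₗᵢ[ℂ] Ell (Pow X b) where
  toFun x := ⟨fun i => WithLp.toLp 2 fun m => x (blockIndex b (i, m)),
    (memℓp_block_iff b _).2 x.2⟩
  invFun ξ := ⟨fun j => ξ ((blockIndex b).symm j).1 ((blockIndex b).symm j).2,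
    (memℓp_block_iff b _).1 (by
      simp only [Equiv.symm_apply_apply]
      exact ξ.2)⟩
  map_add' _ _ := rfl
  map_smul' _ _ := rfl
  left_inv x := by
    ext j
    simp
  right_inv ξ := by
    ext i m
    simp
  norm_map' x := norm_block b x _ fun _ => rfl

theorem blockIso_apply (b : ℕ) [NeZero b] (x : Ell X) (i : ℤ) (m : Fin b) :
    (blockIso X b x i) m = x ((b : ℤ) * i + 1 + (m : ℕ)) := by
  rw [← blockIndex_apply]; rfl

/-- `𝓘_b B 𝓘_b⁻¹`, i.e. the operator `B` rewritten as an operator on `ℓ²(ℤ, Xᵇ)`. -/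
def regroup (b : ℕ) [NeZero b] (B : Op X) :
    Op (Pow X b) :=
  (blockIso X b).toContinuousLinearEquiv.toContinuousLinearMap ∘L B ∘L
    (blockIso X b).symm.toContinuousLinearEquiv.toContinuousLinearMap

/-- The sequence `An = A^{(n)}` (`n = 1, 2, …`) of banded approximations: `A^{(n)} = A` if `A` is
tridiagonal; otherwise, for some `p ≥ 0`, `A^{(n)}` is the operator with the matrix entries
`(1 - |i - j| / (n + 1))ᵖ a_{i,j}` for `|i - j| ≤ n` and `0` for `|i - j| > n`. (An operator on
`ℓ²(ℤ, X)` is determined by its matrix.) -/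
def IsBandedApprox (A : Op X) (An : ℕ → Op X) : Prop :=
  (IsTridiagonal A ∧ ∀ n, 1 ≤ n → An n = A) ∨
  (¬ IsTridiagonal A ∧ ∃ p : ℝ, 0 ≤ p ∧ ∀ n, 1 ≤ n → ∀ i j : ℤ,
    entry (An n) i j =
      if |i - j| ≤ (n : ℤ) then
        ((((1 - ((|i - j| : ℤ) : ℝ) / ((n : ℝ) + 1)) ^ p : ℝ) : ℂ)) • entry A i j
      else 0)

end Block

end BandDom

end

/-! Everything is measured by `recipNormInv (B - λ)`, that is `1/‖(B - λ)⁻¹‖`, which equals the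
minimum of the lower norms of `B - λ` and of its adjoint (`recipNormInv_eq_min`). Pseudospectra are
its sublevel sets, including `ε = 0`. It is 1-Lipschitz in the operator and invariant under
isometric conjugation, so replacing `A` by `A^{(n)}` costs `δ_n`, and regrouping into blocks, which
makes the operator tridiagonal, costs nothing.

For a tridiagonal `B`, restricting to `E_{n,k}` can only raise the lower norm, which puts `Γ` inside
a pseudospectrum. The converse is the localization estimate `mul_norm_le_of_forall_lowerNormOn`: cut
`x` off to every window of length `n` with weights `p` and sum the squares over all windows. The
commutator of `B` with the weights involves only off-diagonal entries and differences of `p`, so the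
loss is `offDiag B` times the ratio of the ℓ² norms of the differences of `p` and of `p`. For the
sine weights, the Dirichlet ground state of the discrete Laplacian, this ratio is `2 sin
(π/(2(n+1)))`. The adjoint is treated by the same estimate through the isometry of `ℓ²(ℤ, Y*)` with
the dual of `ℓ²(ℤ, Y)`.

Relative compactness of the entries makes the family of truncations totally bounded, so finitely
many windows suffice up to `1/n`. This sandwiches `Γ` between `Spec_ε A` and `Spec_{ε+τ_n} A` with
`τ_n → 0`, and a compactness argument shows that the latter sets shrink to the former. -/

noncomputable section

namespace BandDom


/-! ### Lower norms and adjoints -/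

section LowerNorm

variable {V W : Type*} [NormedAddCommGroup V] [NormedSpace ℂ V]
  [NormedAddCommGroup W] [NormedSpace ℂ W]

theorem bddBelow_lowerNorm (B : V →L[ℂ] W) :
    BddBelow ((fun x => ‖B x‖) '' {x : V | ‖x‖ = 1}) :=
  ⟨0, by rintro _ ⟨x, -, rfl⟩; exact norm_nonneg _⟩

theorem lowerNorm_nonneg (B : V →L[ℂ] W) : 0 ≤ lowerNorm B :=
  Real.sInf_nonneg (by rintro _ ⟨x, -, rfl⟩; exact norm_nonneg _)

theorem lowerNorm_mul_norm_le (B : V →L[ℂ] W) (x : V) : lowerNorm B * ‖x‖ ≤ ‖B x‖ := by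
  rcases eq_or_ne x 0 with rfl | hx
  · simp
  have hx' : 0 < ‖x‖ := norm_pos_iff.2 hx
  have h : lowerNorm B ≤ ‖B ((‖x‖⁻¹ : ℂ) • x)‖ :=
    csInf_le (bddBelow_lowerNorm B) ⟨_, by simp [norm_smul, hx'.ne'], rfl⟩
  rw [map_smul, norm_smul, norm_inv, Complex.norm_real, norm_norm, inv_mul_eq_div,
    le_div_iff₀ hx'] at h
  exact h

theorem exists_norm_eq_one_complex (V : Type*) [NormedAddCommGroup V] [NormedSpace ℂ V]
    [Nontrivial V] : ∃ x : V, ‖x‖ = 1 := by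
  obtain ⟨x, hx⟩ := exists_ne (0 : V)
  exact ⟨(‖x‖⁻¹ : ℂ) • x, by simp [norm_smul, hx]⟩

/-- Nontriviality matters: the zero space has an empty unit sphere, and `sInf ∅ = 0`. -/
theorem le_lowerNorm [Nontrivial V] {B : V →L[ℂ] W} {c : ℝ} (h : ∀ x, c * ‖x‖ ≤ ‖B x‖) :
    c ≤ lowerNorm B := by
  obtain ⟨x, hx⟩ := exists_norm_eq_one_complex V
  refine le_csInf ⟨_, x, hx, rfl⟩ ?_
  rintro _ ⟨y, hy, rfl⟩
  simpa [show ‖y‖ = 1 from hy] using h y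

theorem lowerNorm_sub_le [Nontrivial V] (B C : V →L[ℂ] W) :
    lowerNorm B - ‖B - C‖ ≤ lowerNorm C := by
  refine le_lowerNorm fun x => ?_
  have h1 := lowerNorm_mul_norm_le B x
  have h2 := (B - C).le_opNorm x
  have h3 : ‖B x‖ ≤ ‖(B - C) x‖ + ‖C x‖ := by
    simpa using norm_add_le ((B - C) x) (C x)
  linarith

/-- Only the domains need an isometry. Agreement of the norms of the images suffices, so that images
in `ℓ²` can be compared with finite columns. -/
theorem lowerNorm_congr {V' W' : Type*} [NormedAddCommGroup V'] [NormedSpace ℂ V']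
    [NormedAddCommGroup W'] [NormedSpace ℂ W'] (e : V ≃ₗᵢ[ℂ] V') {B : V →L[ℂ] W}
    {B' : V' →L[ℂ] W'} (h : ∀ x, ‖B' (e x)‖ = ‖B x‖) : lowerNorm B = lowerNorm B' := by
  unfold lowerNorm
  congr 1
  ext r
  constructor
  · rintro ⟨x, hx, rfl⟩
    exact ⟨e x, by simpa using hx, h x⟩
  · rintro ⟨y, hy, rfl⟩
    exact ⟨e.symm y, by simpa using hy, by simpa using (h (e.symm y)).symm⟩

theorem lowerNormOn_mul_norm_le (B : V →L[ℂ] W) (Z : Submodule ℂ V) {x : V} (hx : x ∈ Z) :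
    lowerNormOn B Z * ‖x‖ ≤ ‖B x‖ :=
  lowerNorm_mul_norm_le (B ∘L Z.subtypeL) ⟨x, hx⟩

theorem lowerNorm_le_lowerNormOn (B : V →L[ℂ] W) (Z : Submodule ℂ V) [Nontrivial Z] :
    lowerNorm B ≤ lowerNormOn B Z :=
  le_lowerNorm fun x => lowerNorm_mul_norm_le B x

theorem dual_apply (B : V →L[ℂ] W) (f : StrongDual ℂ W) (x : V) : dual B f x = f (B x) := rfl

theorem norm_dual_le (B : V →L[ℂ] W) : ‖dual B‖ ≤ ‖B‖ :=
  ContinuousLinearMap.opNorm_le_bound _ (norm_nonneg _) fun f => by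
    rw [mul_comm]
    exact ContinuousLinearMap.opNorm_comp_le f B

theorem dual_sub (B C : V →L[ℂ] W) : dual (B - C) = dual B - dual C := by
  ext f x; simp [dual_apply]

end LowerNorm

/-! ### The norm of the inverse in terms of lower norms -/

section RecipNormInv

variable {V : Type*} [NormedAddCommGroup V] [NormedSpace ℂ V]

theorem nontrivial_strongDual (V : Type*) [NormedAddCommGroup V] [NormedSpace ℂ V]
    [Nontrivial V] : Nontrivial (StrongDual ℂ V) := by
  obtain ⟨g, hg, -⟩ := exists_dual_vector' ℂ (0 : V)
  exact ⟨g, 0, fun h => by simp [h] at hg⟩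

/-- A positive lower norm gives injectivity and closed range. If the range were proper, Hahn–Banach
would produce a non-zero functional that vanishes on it, an element of the kernel of the adjoint. -/
theorem isUnit_of_lowerNorm_pos [CompleteSpace V] {B : V →L[ℂ] V} (h : 0 < lowerNorm B)
    (h' : 0 < lowerNorm (dual B)) : IsUnit B := by
  rw [ContinuousLinearMap.isUnit_iff_bijective]
  have hanti : AntilipschitzWith (lowerNorm B)⁻¹.toNNReal B :=
    AddMonoidHomClass.antilipschitz_of_bound B fun x => by
      rw [Real.coe_toNNReal _ (inv_nonneg.2 h.le), inv_mul_eq_div, le_div_iff₀ h, mul_comm]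
      exact lowerNorm_mul_norm_le B x
  refine ⟨hanti.injective, ?_⟩
  have hclosed : IsClosed (range B) := hanti.isClosed_range B.uniformContinuous
  by_contra hsurj
  obtain ⟨y, hy⟩ : ∃ y, y ∉ range B := by
    by_contra! hc
    exact hsurj fun y => hc y
  obtain ⟨f, u, hu, huy⟩ := RCLike.geometric_hahn_banach_closed_point (𝕜 := ℂ)
    (s := range B) (by
      rintro _ ⟨x, rfl⟩ _ ⟨y, rfl⟩ a b - - -
      exact ⟨(a : ℂ) • x + (b : ℂ) • y, by simp⟩) hclosed hy
  have h0 : 0 < u := by simpa using hu 0 ⟨0, by simp⟩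
  have hf : dual B f = 0 := by
    ext x
    rw [dual_apply, zero_apply]
    by_contra hne
    -- Rescaled so that `f` takes the value `u`, this point of the range violates the strict bound
    -- `re f < u`.
    have := hu (B (((u : ℂ) / f (B x)) • x)) ⟨_, rfl⟩
    rw [map_smul, map_smul, smul_eq_mul, div_mul_cancel₀ _ hne] at this
    simp at this
  have h2 := lowerNorm_mul_norm_le (dual B) f
  rw [hf, norm_zero] at h2
  have h3 : f = 0 := norm_le_zero_iff.1 (nonpos_of_mul_nonpos_right h2 h')
  simp [h3] at huy
  linarith

theorem recipNormInv_pos [Nontrivial V] {B : V →L[ℂ] V} (hB : IsUnit B) :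
    0 < recipNormInv B := by
  rw [recipNormInv, if_pos hB]
  have : Ring.inverse B ≠ 0 := by
    obtain ⟨u, rfl⟩ := hB
    simp
  have := norm_pos_iff.2 this
  positivity

/-- A two-sided inverse computes `1 / ‖B⁻¹‖`. -/
theorem recipNormInv_eq {B C : V →L[ℂ] V} (h : B * C = 1) (h' : C * B = 1) :
    recipNormInv B = 1 / ‖C‖ := by
  have := Ring.inverse_unit (⟨B, C, h, h'⟩ : (V →L[ℂ] V)ˣ)
  rw [recipNormInv, if_pos (⟨B, C, h, h'⟩ : (V →L[ℂ] V)ˣ).isUnit]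
  simp at this
  rw [this]

theorem one_div_norm_le_lowerNorm {W : Type*} [NormedAddCommGroup W] [NormedSpace ℂ W]
    [Nontrivial V] {B : V →L[ℂ] W} {C : W →L[ℂ] V} (h : ∀ x, C (B x) = x) :
    1 / ‖C‖ ≤ lowerNorm B := by
  refine le_lowerNorm fun x => ?_
  have h1 : ‖x‖ ≤ ‖C‖ * ‖B x‖ := by simpa [h] using C.le_opNorm (B x)
  rcases (norm_nonneg C).eq_or_lt with h0 | h0
  · simp [← h0]
  · rw [one_div, inv_mul_eq_div, div_le_iff₀ h0]
    linarith

/-- `1 / ‖B⁻¹‖ = min (ν(B), ν(B*))`. -/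
theorem recipNormInv_eq_min [CompleteSpace V] [Nontrivial V] (B : V →L[ℂ] V) :
    recipNormInv B = min (lowerNorm B) (lowerNorm (dual B)) := by
  have := nontrivial_strongDual V
  by_cases hB : IsUnit B
  · obtain ⟨⟨B, C, h, h'⟩, rfl⟩ := hB
    change recipNormInv B = min (lowerNorm B) (lowerNorm (dual B))
    have hx : ∀ x, C (B x) = x := fun x => by simpa using congr($h' x)
    have hx' : ∀ x, B (C x) = x := fun x => by simpa using congr($h x)
    rw [recipNormInv_eq h h']
    have hC : 0 < ‖C‖ := by
      refine norm_pos_iff.2 ?_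
      rintro rfl
      obtain ⟨x, hx0⟩ := exists_ne (0 : V)
      exact hx0 (by simpa using (hx x).symm)
    apply le_antisymm
    · refine le_min (one_div_norm_le_lowerNorm hx) ?_
      refine le_trans ?_ (one_div_norm_le_lowerNorm (B := dual B) (C := dual C) fun f => by
        ext x; simp [dual_apply, hx'])
      -- With `1 / 0 = 0` the inequality could fail if `‖dual C‖ = 0`. This is excluded because
      -- `dual C` has an inverse on a non-zero space.
      rcases (norm_nonneg (dual C)).eq_or_lt with h0 | h0
      · exfalso
        obtain ⟨f, hf⟩ := exists_ne (0 : StrongDual ℂ V)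
        have h1 : dual C f = 0 := by
          refine norm_le_zero_iff.1 (((dual C).le_opNorm f).trans ?_)
          rw [← h0, zero_mul]
        refine hf ?_
        ext x
        simpa [dual_apply, hx] using congr($h1 (B x))
      · exact one_div_le_one_div_of_le h0 (norm_dual_le C)
    · refine (min_le_left _ _).trans ?_
      rw [le_div_iff₀ hC]
      rcases (lowerNorm_nonneg B).eq_or_lt with h0 | h0
      · simp [← h0]
      rw [← le_div_iff₀' h0]
      refine C.opNorm_le_bound (by positivity) fun x => ?_
      have := lowerNorm_mul_norm_le B (C x)
      rw [hx'] at this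
      rw [one_div, inv_mul_eq_div, le_div_iff₀ h0]
      linarith
  · rw [recipNormInv, if_neg hB]
    refine le_antisymm (le_min (lowerNorm_nonneg _) (lowerNorm_nonneg _)) ?_
    by_contra! hc
    exact hB (isUnit_of_lowerNorm_pos (lt_min_iff.1 hc).1 (lt_min_iff.1 hc).2)

/-- Both lower norms are 1-Lipschitz and the adjoint does not increase norms, so no distinction by
invertibility is needed. -/
theorem recipNormInv_sub_le [CompleteSpace V] [Nontrivial V] (B C : V →L[ℂ] V) :
    recipNormInv B - ‖B - C‖ ≤ recipNormInv C := by
  have := nontrivial_strongDual V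
  rw [recipNormInv_eq_min, recipNormInv_eq_min]
  have h1 := lowerNorm_sub_le B C
  have h2 := lowerNorm_sub_le (dual B) (dual C)
  rw [← dual_sub] at h2
  have h3 := norm_dual_le (B - C)
  refine le_min ?_ ?_
  · linarith [min_le_left (lowerNorm B) (lowerNorm (dual B))]
  · linarith [min_le_right (lowerNorm B) (lowerNorm (dual B))]

theorem recipNormInv_conj_of_isUnit {W : Type*} [NormedAddCommGroup W] [NormedSpace ℂ W]
    (e : V ≃ₗᵢ[ℂ] W) {B : V →L[ℂ] V} {B' : W →L[ℂ] W} (h : ∀ x, B' (e x) = e (B x))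
    (hB : IsUnit B) : recipNormInv B' = recipNormInv B := by
  obtain ⟨⟨B, C, h1, h2⟩, rfl⟩ := hB
  change ∀ x, B' (e x) = e (B x) at h
  change recipNormInv B' = recipNormInv B
  have hx : ∀ x, C (B x) = x := fun x => by simpa using congr($h2 x)
  have hx' : ∀ x, B (C x) = x := fun x => by simpa using congr($h1 x)
  let C' : W →L[ℂ] W := e.toContinuousLinearEquiv.toContinuousLinearMap ∘L C ∘L
    e.symm.toContinuousLinearEquiv.toContinuousLinearMap
  have hC' : ∀ y, C' y = e (C (e.symm y)) := fun y => rfl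
  have h3 : ∀ y, B' y = e (B (e.symm y)) := fun y => by rw [← h, e.apply_symm_apply]
  rw [recipNormInv_eq h1 h2, recipNormInv_eq (C := C')]
  · congr 1
    apply le_antisymm
    · refine C'.opNorm_le_bound (norm_nonneg _) fun y => ?_
      rw [hC', e.norm_map]
      simpa using C.le_opNorm (e.symm y)
    · refine C.opNorm_le_bound (norm_nonneg _) fun y => ?_
      simpa [hC'] using C'.le_opNorm (e y)
  · ext y; simp [hC', h3, hx']
  · ext y; simp [hC', h3, hx]

/-- `1 / ‖B⁻¹‖` is invariant under conjugation by an isometric isomorphism. -/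
theorem recipNormInv_conj {W : Type*} [NormedAddCommGroup W] [NormedSpace ℂ W]
    (e : V ≃ₗᵢ[ℂ] W) {B : V →L[ℂ] V} {B' : W →L[ℂ] W} (h : ∀ x, B' (e x) = e (B x)) :
    recipNormInv B' = recipNormInv B := by
  by_cases hB : IsUnit B
  · exact recipNormInv_conj_of_isUnit e h hB
  by_cases hB' : IsUnit B'
  · refine (recipNormInv_conj_of_isUnit e.symm (fun x => ?_) hB').symm
    rw [e.eq_symm_apply, ← h, e.apply_symm_apply]
  · rw [recipNormInv, recipNormInv, if_neg hB, if_neg hB']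

end RecipNormInv


/-! ### The dual of `ℓ²(ℤ, Y)` and the transposed operator -/

section Duality

variable {Y : Type*} [NormedAddCommGroup Y] [NormedSpace ℂ Y]

theorem coord_apply (j : ℤ) (x : Ell Y) : coord j x = x j := rfl

theorem embed_apply (j : ℤ) (y : Y) (i : ℤ) : embed j y i = if i = j then y else 0 := by
  change lp.single (E := fun _ : ℤ => Y) 2 j y i = _
  rw [lp.single_apply, Pi.single_apply]

theorem norm_embed (j : ℤ) (y : Y) : ‖embed j y‖ = ‖y‖ :=
  lp.norm_single (E := fun _ : ℤ => Y) (p := 2) two_pos j y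

theorem sum_embed_apply (s : Finset ℤ) (f : ℤ → Y) (i : ℤ) :
    (∑ j ∈ s, embed j (f j)) i = if i ∈ s then f i else 0 := by
  rw [← coord_apply, map_sum]
  simp only [coord_apply, embed_apply, Finset.sum_ite_eq]

theorem norm_sq_sum_embed (s : Finset ℤ) (f : ℤ → Y) :
    ‖∑ j ∈ s, embed j (f j)‖ ^ 2 = ∑ j ∈ s, ‖f j‖ ^ 2 := by
  have := lp.norm_sum_single (E := fun _ : ℤ => Y) (p := 2) (by norm_num) f s
  simp only [ENNReal.toReal_ofNat, Real.rpow_ofNat] at this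
  exact this

theorem hasSum_embed (x : Ell Y) : HasSum (fun j => embed j (x j)) x :=
  lp.hasSum_single (by norm_num) x

theorem hasSum_norm_sq {Z : Type*} [NormedAddCommGroup Z] (x : Ell Z) :
    HasSum (fun j => ‖x j‖ ^ 2) (‖x‖ ^ 2) := by
  rw [norm_sq_eq_tsum]
  exact ((memℓp_iff_sq fun i => x i).1 (lp.memℓp x)).hasSum

theorem hasSum_entry (B : Op Y) (x : Ell Y) (i : ℤ) :
    HasSum (fun j => entry B i j (x j)) (B x i) :=
  ((hasSum_embed x).mapL B).mapL (coord i)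

theorem entry_apply (B : Op Y) (i j : ℤ) (y : Y) : entry B i j y = B (embed j y) i := rfl

theorem norm_entry_le (B : Op Y) (i j : ℤ) : ‖entry B i j‖ ≤ ‖B‖ := by
  refine ContinuousLinearMap.opNorm_le_bound _ (norm_nonneg _) fun y => ?_
  rw [entry_apply]
  refine (lp.norm_apply_le_norm two_ne_zero _ i).trans ?_
  simpa [norm_embed] using B.le_opNorm (embed j y)

/-- A functional almost attains its norm squared on the ball of radius its norm. -/
theorem exists_apply_eq_mul_norm_sq (g : StrongDual ℂ Y) {t : ℝ} (ht0 : 0 ≤ t) (ht : t < 1) :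
    ∃ y, ‖y‖ ≤ ‖g‖ ∧ g y = ((t * ‖g‖ ^ 2 : ℝ) : ℂ) := by
  rcases (norm_nonneg g).eq_or_lt with h0 | h0
  · exact ⟨0, by simp, by simp [← h0]⟩
  · obtain ⟨x, hx, hgx⟩ := g.exists_lt_apply_of_lt_opNorm (r := t * ‖g‖) (by nlinarith)
    have hpos : 0 < ‖g x‖ := lt_of_le_of_lt (by positivity) hgx
    have hne : g x ≠ 0 := norm_pos_iff.1 hpos
    refine ⟨(((t * ‖g‖ ^ 2 : ℝ) : ℂ) / g x) • x, ?_, ?_⟩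
    · rw [norm_smul, norm_div, Complex.norm_real, Real.norm_of_nonneg (by positivity)]
      have h1 : t * ‖g‖ ^ 2 / ‖g x‖ ≤ ‖g‖ := by
        rw [div_le_iff₀ hpos]; nlinarith
      calc _ ≤ ‖g‖ * 1 := mul_le_mul h1 hx.le (norm_nonneg _) h0.le
        _ = ‖g‖ := mul_one _
    · rw [map_smul, smul_eq_mul, div_mul_cancel₀ _ hne]

/-- Test `f` on a finite sequence whose entries satisfy `‖y_j‖ ≤ ‖f_j‖` and `f_j y_j = t ‖f_j‖²`.
This gives `t N² ≤ ‖f‖ N`, and then `t → 1`. The factor `t < 1` is there because a functional need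
not attain its norm. -/
theorem sum_norm_sq_comp_embed_le (f : StrongDual ℂ (Ell Y)) (s : Finset ℤ) :
    ∑ j ∈ s, ‖f ∘L embed j‖ ^ 2 ≤ ‖f‖ ^ 2 := by
  set N := √(∑ j ∈ s, ‖f ∘L embed j‖ ^ 2) with hN
  have hN2 : N ^ 2 = ∑ j ∈ s, ‖f ∘L embed j‖ ^ 2 :=
    Real.sq_sqrt (Finset.sum_nonneg fun _ _ => by positivity)
  have hN0 : 0 ≤ N := Real.sqrt_nonneg _
  have key : ∀ t ∈ Ico (0 : ℝ) 1, t * N ≤ ‖f‖ := by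
    rintro t ⟨ht0, ht⟩
    rcases hN0.eq_or_lt with h0 | h0
    · simp [← h0]
    choose y hy hfy using fun j => exists_apply_eq_mul_norm_sq (f ∘L embed j) ht0 ht
    have h1 : f (∑ j ∈ s, embed j (y j)) = ((t * N ^ 2 : ℝ) : ℂ) := by
      rw [map_sum, hN2, Finset.mul_sum, Complex.ofReal_sum]
      exact Finset.sum_congr rfl fun j _ => hfy j
    have h2 : ‖∑ j ∈ s, embed j (y j)‖ ≤ N := by
      rw [← sq_le_sq₀ (norm_nonneg _) hN0, norm_sq_sum_embed, hN2]
      exact Finset.sum_le_sum fun j _ => by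
        have := hy j
        gcongr
    have h3 := f.le_opNorm (∑ j ∈ s, embed j (y j))
    rw [h1, Complex.norm_real, Real.norm_of_nonneg (by positivity)] at h3
    have h4 : ‖f‖ * ‖∑ j ∈ s, embed j (y j)‖ ≤ ‖f‖ * N := by gcongr
    nlinarith
  have h1 : N ≤ ‖f‖ := by
    have h2 : Tendsto (fun t : ℝ => t * N) (𝓝[<] 1) (𝓝 (1 * N)) :=
      ((continuous_id.mul continuous_const).tendsto 1).mono_left nhdsWithin_le_nhds
    rw [one_mul] at h2
    exact le_of_tendsto h2 (by
      filter_upwards [Ico_mem_nhdsLT (zero_lt_one' ℝ)] with t ht using key t ht)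
  rw [← hN2]
  gcongr

/-- The canonical pairing `ℓ²(ℤ, Y*) → ℓ²(ℤ, Y)*`. -/
def pairing (Y : Type*) [NormedAddCommGroup Y] [NormedSpace ℂ Y] :
    Ell (StrongDual ℂ Y) →L[ℂ] StrongDual ℂ (Ell Y) :=
  lp.dualPairing 2 2 (fun _ : ℤ => ContinuousLinearMap.id ℂ (StrongDual ℂ Y)) (K := 1)
    fun _ => ContinuousLinearMap.norm_id_le

theorem pairing_apply (g : Ell (StrongDual ℂ Y)) (x : Ell Y) :
    pairing Y g x = ∑' j, g j (x j) :=
  lp.dualPairing_apply _ _ g x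

theorem pairing_embed (g : Ell (StrongDual ℂ Y)) (j : ℤ) (y : Y) :
    pairing Y g (embed j y) = g j y := by
  rw [pairing_apply, tsum_eq_single j]
  · simp [embed_apply]
  · intro i hi
    simp [embed_apply, hi]

theorem norm_pairing_le (g : Ell (StrongDual ℂ Y)) : ‖pairing Y g‖ ≤ ‖g‖ := by
  have h : ‖pairing Y‖ ≤ 1 := lp.norm_dualPairing _ _
  simpa using (pairing Y).le_of_opNorm_le h g

theorem memℓp_comp_embed (f : StrongDual ℂ (Ell Y)) :
    Memℓp (fun j : ℤ => f ∘L (embed j : Y →L[ℂ] Ell Y)) 2 := by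
  rw [memℓp_iff_sq]
  exact summable_of_sum_le (fun _ => by positivity) (sum_norm_sq_comp_embed_le f)

/-- The isometric isomorphism `ℓ²(ℤ, Y*) ≃ ℓ²(ℤ, Y)*`. -/
def dualIso (Y : Type*) [NormedAddCommGroup Y] [NormedSpace ℂ Y] :
    Ell (StrongDual ℂ Y) ≃ₗᵢ[ℂ] StrongDual ℂ (Ell Y) where
  toFun g := pairing Y g
  map_add' := map_add _
  map_smul' := map_smul _
  invFun f := ⟨fun j => f ∘L embed j, memℓp_comp_embed f⟩
  left_inv g := by
    ext j y
    exact pairing_embed g j y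
  right_inv f := by
    ext x
    refine ((hasSum_embed x).mapL _).unique ?_
    convert! (hasSum_embed x).mapL f using 2 with j
    exact pairing_embed _ j (x j)
  norm_map' g := by
    refine le_antisymm (norm_pairing_le g) ?_
    change ‖g‖ ≤ ‖pairing Y g‖
    rw [← sq_le_sq₀ (norm_nonneg _) (norm_nonneg _), norm_sq_eq_tsum]
    refine ((memℓp_iff_sq fun i => g i).1 (lp.memℓp g)).tsum_le_of_sum_le fun s => ?_
    have h : ∀ j, pairing Y g ∘L embed j = g j := fun j => by
      ext y
      exact pairing_embed g j y
    simpa only [h] using sum_norm_sq_comp_embed_le (pairing Y g) s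

theorem dualIso_embed (g : Ell (StrongDual ℂ Y)) (j : ℤ) (y : Y) :
    dualIso Y g (embed j y) = g j y := pairing_embed g j y

theorem dualIso_symm_apply (f : StrongDual ℂ (Ell Y)) (j : ℤ) (y : Y) :
    (dualIso Y).symm f j y = f (embed j y) := rfl

theorem dualIso_single_apply (j : ℤ) (g : StrongDual ℂ Y) (x : Ell Y) :
    dualIso Y (embed j g) x = g (x j) := by
  refine (pairing_apply _ _).trans ?_
  rw [tsum_eq_single j]
  · simp [embed_apply]
  · intro i hi
    simp [embed_apply, hi]

/-- The adjoint of `B`, as an operator on `ℓ²(ℤ, Y*)`. -/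
def transpose (B : Op Y) : Op (StrongDual ℂ Y) :=
  (dualIso Y).symm.toContinuousLinearEquiv.toContinuousLinearMap ∘L dual B ∘L
    (dualIso Y).toContinuousLinearEquiv.toContinuousLinearMap

theorem dualIso_transpose (B : Op Y) (g : Ell (StrongDual ℂ Y)) :
    dualIso Y (transpose B g) = dual B (dualIso Y g) :=
  (dualIso Y).apply_symm_apply _

theorem entry_transpose (B : Op Y) (i j : ℤ) :
    entry (transpose B) i j = dual (entry B j i) := by
  ext g y
  change (dualIso Y).symm (dual B (dualIso Y (embed j g))) i y = _
  rw [dualIso_symm_apply, dual_apply, dualIso_single_apply]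
  rfl

theorem subScalar_apply {V : Type*} [NormedAddCommGroup V] [NormedSpace ℂ V] (B : V →L[ℂ] V)
    (z : ℂ) (x : V) : subScalar B z x = B x - z • x := rfl

theorem entry_subScalar (B : Op Y) (z : ℂ) (i j : ℤ) :
    entry (subScalar B z) i j = entry B i j - if i = j then z • ContinuousLinearMap.id ℂ Y else 0 := by
  ext y
  rw [entry_apply, subScalar_apply, lp.coeFn_sub, lp.coeFn_smul, Pi.sub_apply, Pi.smul_apply,
    embed_apply]
  split_ifs with h <;> simp [entry_apply]

theorem dual_subScalar {V : Type*} [NormedAddCommGroup V] [NormedSpace ℂ V] (B : V →L[ℂ] V)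
    (z : ℂ) : dual (subScalar B z) = subScalar (dual B) z := by
  ext f x
  simp [dual_apply, subScalar]

theorem transpose_subScalar (B : Op Y) (z : ℂ) :
    transpose (subScalar B z) = subScalar (transpose B) z := by
  ext1 g
  apply (dualIso Y).injective
  rw [dualIso_transpose, dual_subScalar]
  simp [subScalar, dualIso_transpose]

theorem HasBandwidth.transpose {B : Op Y} {w : ℕ} (h : HasBandwidth B w) :
    HasBandwidth (transpose B) w := fun i j hij => by
  rw [entry_transpose, h j i (by rwa [abs_sub_comm])]
  ext f x
  simp [dual_apply]

theorem HasBandwidth.subScalar {B : Op Y} {w : ℕ} (h : HasBandwidth B w) (z : ℂ) :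
    HasBandwidth (subScalar B z) w := fun i j hij => by
  rw [entry_subScalar, h i j hij, if_neg, sub_zero]
  rintro rfl
  simp at hij
  omega

theorem lowerNorm_transpose (B : Op Y) : lowerNorm (transpose B) = lowerNorm (dual B) :=
  lowerNorm_congr (dualIso Y) fun g => by
    rw [← dualIso_transpose, (dualIso Y).norm_map]

theorem proj_apply (n : ℕ) (k : ℤ) (x : Ell Y) (i : ℤ) :
    proj n k x i = if i ∈ Finset.Icc (k + 1) (k + n) then x i else 0 := by
  have : proj n k x = ∑ j ∈ Finset.Icc (k + 1) (k + n), embed j (x j) := by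
    simp [proj, coord_apply]
  rw [this, sum_embed_apply]

theorem mem_sectionSpace {n : ℕ} {k : ℤ} {x : Ell Y} :
    x ∈ sectionSpace Y n k ↔ ∀ i, i ∉ Finset.Icc (k + 1) (k + n) → x i = 0 := by
  constructor
  · rintro ⟨y, rfl⟩ i hi
    exact (proj_apply n k y i).trans (if_neg hi)
  · intro h
    refine ⟨x, ?_⟩
    ext i
    refine (proj_apply n k x i).trans ?_
    split_ifs with hi
    · rfl
    · exact (h i hi).symm

/-- Through this, `dualIso` matches `dualSectionSpace` with the section space over `Y*`. -/
theorem transpose_proj (n : ℕ) (k : ℤ) :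
    transpose (proj n k : Op Y) = proj n k := by
  ext g i y
  change (dualIso Y).symm (dual (proj n k) (dualIso Y g)) i y = _
  rw [dualIso_symm_apply, dual_apply, proj_apply]
  have : proj n k (embed i y) = if i ∈ Finset.Icc (k + 1) (k + n) then embed i y else 0 := by
    ext j
    rw [proj_apply]
    by_cases hij : j = i
    · subst hij
      split_ifs <;> rfl
    · split_ifs <;> simp [embed_apply, hij]
  rw [this]
  split_ifs
  · exact dualIso_embed g i y
  · simp

theorem mem_dualSectionSpace {n : ℕ} {k : ℤ} {g : Ell (StrongDual ℂ Y)} :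
    dualIso Y g ∈ dualSectionSpace Y n k ↔ g ∈ sectionSpace (StrongDual ℂ Y) n k := by
  constructor
  · rintro ⟨f, hf⟩
    refine ⟨(dualIso Y).symm f, (dualIso Y).injective ?_⟩
    change dualIso Y (proj n k _) = _
    rw [← transpose_proj, dualIso_transpose, (dualIso Y).apply_symm_apply]
    exact hf
  · rintro ⟨h, rfl⟩
    refine ⟨dualIso Y h, ?_⟩
    change dual (proj n k) (dualIso Y h) = dualIso Y (proj n k h)
    rw [← dualIso_transpose, transpose_proj]

theorem lowerNormOn_dual (B : Op Y) (n : ℕ) (k : ℤ) :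
    lowerNormOn (dual B) (dualSectionSpace Y n k) =
      lowerNormOn (transpose B) (sectionSpace (StrongDual ℂ Y) n k) := by
  symm
  let e : sectionSpace (StrongDual ℂ Y) n k ≃ₗᵢ[ℂ] dualSectionSpace Y n k :=
    { toFun := fun g => ⟨dualIso Y g, mem_dualSectionSpace.2 g.2⟩
      map_add' := fun _ _ => by ext1; exact map_add _ _ _
      map_smul' := fun _ _ => by ext1; exact map_smul _ _ _
      invFun := fun f => ⟨(dualIso Y).symm f, mem_dualSectionSpace.1 (by simp)⟩
      left_inv := fun g => by simp
      right_inv := fun g => by simp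
      norm_map' := fun g => (dualIso Y).norm_map _ }
  refine lowerNorm_congr e fun g => ?_
  change ‖dual B (dualIso Y g)‖ = ‖transpose B g‖
  rw [← dualIso_transpose, (dualIso Y).norm_map]

theorem truncPlusDual_eq (n : ℕ) (k : ℤ) (B : Op Y) :
    truncPlusDual n k B = truncPlus n k (transpose B) := by
  simp only [truncPlusDual, truncPlus, entry_transpose]

end Duality


/-! ### Restrictions to `E_{n,k}` as rectangular matrices -/

section Truncation

variable {Y : Type*} [NormedAddCommGroup Y] [NormedSpace ℂ Y]

/-- The embedding of `{0, …, m - 1}` into `ℤ` that starts at `k`. -/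
def shiftIdx (m : ℕ) (k : ℤ) (c : Fin m) : ℤ := k + (c : ℕ)

theorem shiftIdx_injective (m : ℕ) (k : ℤ) : Function.Injective (shiftIdx m k) := by
  intro a b h
  simp only [shiftIdx] at h
  exact Fin.ext (by omega)

theorem mem_range_shiftIdx {m : ℕ} {k i : ℤ} : i ∈ range (shiftIdx m k) ↔ k ≤ i ∧ i < k + m := by
  constructor
  · rintro ⟨c, rfl⟩
    have := c.2
    simp only [shiftIdx]
    omega
  · rintro ⟨h1, h2⟩
    exact ⟨⟨(i - k).toNat, by omega⟩, by simp only [shiftIdx]; omega⟩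

theorem norm_sq_eq_sum_shiftIdx {Z : Type*} [NormedAddCommGroup Z] {m : ℕ} {k : ℤ} (x : Ell Z)
    (h : ∀ i, i ∉ range (shiftIdx m k) → x i = 0) :
    ‖x‖ ^ 2 = ∑ c, ‖x (shiftIdx m k c)‖ ^ 2 := by
  have h1 := (Function.Injective.hasSum_iff (shiftIdx_injective m k)
    (f := fun i => ‖x i‖ ^ 2) (fun i hi => by simp [h i hi])).2 (hasSum_norm_sq x)
  exact h1.unique (hasSum_fintype _)

theorem apply_eq_sum_shiftIdx (B : Op Y) {m : ℕ} {k : ℤ} (x : Ell Y)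
    (h : ∀ i, i ∉ range (shiftIdx m k) → x i = 0) (i : ℤ) :
    B x i = ∑ c, entry B i (shiftIdx m k c) (x (shiftIdx m k c)) := by
  have h1 := (Function.Injective.hasSum_iff (shiftIdx_injective m k)
    (f := fun j => entry B i j (x j)) (fun j hj => by simp [h j hj])).2 (hasSum_entry B x i)
  exact h1.unique (hasSum_fintype _)

theorem mem_sectionSpace_iff_shiftIdx {n : ℕ} {k : ℤ} {x : Ell Y} :
    x ∈ sectionSpace Y n k ↔ ∀ i, i ∉ range (shiftIdx n (k + 1)) → x i = 0 := by
  rw [mem_sectionSpace]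
  refine forall_congr' fun i => ?_
  rw [mem_range_shiftIdx, Finset.mem_Icc]
  have : (k + 1 ≤ i ∧ i ≤ k + n) ↔ (k + 1 ≤ i ∧ i < k + 1 + n) := by omega
  rw [this]

theorem sum_embed_shiftIdx_apply {n : ℕ} {k : ℤ} (ξ : Fin n → Y) (c : Fin n) :
    (∑ d, embed (shiftIdx n k d) (ξ d)) (shiftIdx n k c) = ξ c := by
  rw [← coord_apply, map_sum]
  simp only [coord_apply, embed_apply, (shiftIdx_injective n k).eq_iff]
  simp

theorem sum_embed_shiftIdx_apply_of_notMem {n : ℕ} {k : ℤ} (ξ : Fin n → Y) {i : ℤ}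
    (hi : i ∉ range (shiftIdx n k)) :
    (∑ d, embed (shiftIdx n k d) (ξ d)) i = 0 := by
  rw [← coord_apply, map_sum]
  refine Finset.sum_eq_zero fun d _ => ?_
  rw [coord_apply, embed_apply, if_neg]
  rintro rfl
  exact hi ⟨d, rfl⟩

/-- `E_{n,k}` is isometrically isomorphic to `Yⁿ`. -/
def sectionIso (Y : Type*) [NormedAddCommGroup Y] [NormedSpace ℂ Y] (n : ℕ) (k : ℤ) :
    sectionSpace Y n k ≃ₗᵢ[ℂ] Pow Y n :=
  LinearIsometryEquiv.ofSurjective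
    { toFun := fun x => WithLp.toLp 2 fun c => (x : Ell Y) (shiftIdx n (k + 1) c)
      map_add' := fun _ _ => rfl
      map_smul' := fun _ _ => rfl
      norm_map' := fun x => by
        refine (sq_eq_sq₀ (norm_nonneg _) (norm_nonneg _)).1 ?_
        change ‖WithLp.toLp 2 fun c => (x : Ell Y) (shiftIdx n (k + 1) c)‖ ^ 2 = ‖(x : Ell Y)‖ ^ 2
        rw [block_norm_sq, norm_sq_eq_sum_shiftIdx _ (mem_sectionSpace_iff_shiftIdx.1 x.2)] }
    (fun ξ => ⟨⟨∑ c, embed (shiftIdx n (k + 1) c) (ξ c), mem_sectionSpace_iff_shiftIdx.2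
        fun _ hi => sum_embed_shiftIdx_apply_of_notMem _ hi⟩, by
      ext c
      exact sum_embed_shiftIdx_apply (fun c => ξ c) c⟩)

theorem ofEntries_apply {m n : ℕ} (M : Fin m → Fin n → (Y →L[ℂ] Y)) (ξ : Pow Y n) (r : Fin m) :
    ofEntries M ξ r = ∑ c, M r c (ξ c) := by
  change (∑ c, M r c ∘L PiLp.proj (𝕜 := ℂ) 2 (fun _ : Fin n => Y) c) ξ = _
  simp

/-- A tridiagonal operator spreads a support by one index on each side, so the `n + 2` rows `k, …, k
+ n + 1` carry all of `B x` for `x ∈ E_{n,k}`. -/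
theorem lowerNormOn_sectionSpace {B : Op Y} (hB : IsTridiagonal B) (n : ℕ) (k : ℤ) :
    lowerNormOn B (sectionSpace Y n k) = lowerNorm (truncPlus n k B) := by
  refine lowerNorm_congr (sectionIso Y n k) fun x => ?_
  have hx := mem_sectionSpace_iff_shiftIdx.1 x.2
  refine (sq_eq_sq₀ (norm_nonneg _) (norm_nonneg _)).1 ?_
  change _ = ‖B x‖ ^ 2
  rw [PiLp.norm_sq_eq_of_L2, norm_sq_eq_sum_shiftIdx (m := n + 2) (k := k) (B x)]
  · refine Finset.sum_congr rfl fun r _ => ?_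
    rw [apply_eq_sum_shiftIdx B _ hx, truncPlus, ofEntries_apply]
    rfl
  · intro i hi
    rw [apply_eq_sum_shiftIdx B _ hx]
    refine Finset.sum_eq_zero fun c _ => ?_
    rw [hB, zero_apply]
    rw [mem_range_shiftIdx] at hi
    have := c.2
    simp only [shiftIdx]
    rw [lt_abs]
    push_cast at hi ⊢
    omega

theorem truncPlus_subScalar (B : Op Y) (n : ℕ) (k : ℤ) (z : ℂ) :
    truncPlus n k (subScalar B z) = truncPlus n k B - z • idPlus Y n := by
  ext ξ r
  rw [sub_apply, smul_apply, PiLp.sub_apply, PiLp.smul_apply, truncPlus, truncPlus, idPlus,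
    ofEntries_apply, ofEntries_apply, ofEntries_apply, Finset.smul_sum, ← Finset.sum_sub_distrib]
  refine Finset.sum_congr rfl fun c _ => ?_
  rw [entry_subScalar]
  by_cases h : (r : ℕ) = c + 1
  · rw [if_pos h, if_pos (by omega)]; rfl
  · rw [if_neg h, if_neg (by omega)]; simp

theorem muFin_subScalar {B : Op Y} (hB : IsTridiagonal B) (n : ℕ) (K : Finset ℤ) (z : ℂ) :
    muFin n K (subScalar B z) = muFinMat n K B z := by
  unfold muFin muFinMat
  refine iInf_congr fun k => ?_
  rw [lowerNormOn_dual, lowerNormOn_sectionSpace (hB.subScalar z),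
    lowerNormOn_sectionSpace (hB.subScalar z).transpose, transpose_subScalar, truncPlus_subScalar,
    truncPlus_subScalar, truncPlusDual_eq]

end Truncation


/-! ### Minkowski's inequality for square-summable families -/

section Minkowski

/-- Expand the square on finite sets and apply Cauchy–Schwarz to the cross terms. The uniform bound
gives summability at the same time. -/
theorem summable_sq_of_le_add {ι : Type*} {f a b c : ι → ℝ} {A B C : ℝ}
    (hf : ∀ i, 0 ≤ f i) (hfle : ∀ i, f i ≤ a i + b i + c i)
    (hA : 0 ≤ A) (hB : 0 ≤ B) (hC : 0 ≤ C) (ha : HasSum (fun i => a i ^ 2) (A ^ 2))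
    (hb : HasSum (fun i => b i ^ 2) (B ^ 2)) (hc : HasSum (fun i => c i ^ 2) (C ^ 2)) :
    (Summable fun i => f i ^ 2) ∧ ∑' i, f i ^ 2 ≤ (A + B + C) ^ 2 := by
  have key : ∀ s : Finset ι, ∑ i ∈ s, f i ^ 2 ≤ (A + B + C) ^ 2 := by
    intro s
    have hle : ∀ {u : ι → ℝ} {U : ℝ}, 0 ≤ U → HasSum (fun i => u i ^ 2) (U ^ 2) →
        √(∑ i ∈ s, u i ^ 2) ≤ U ∧ ∑ i ∈ s, u i ^ 2 ≤ U ^ 2 := fun hU hu => by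
      have := sum_le_hasSum s (fun i _ => by positivity) hu
      exact ⟨Real.sqrt_le_iff.2 ⟨hU, this⟩, this⟩
    have hmul : ∀ {u v : ι → ℝ} {U V : ℝ}, 0 ≤ U → HasSum (fun i => u i ^ 2) (U ^ 2) → 0 ≤ V →
        HasSum (fun i => v i ^ 2) (V ^ 2) → ∑ i ∈ s, u i * v i ≤ U * V :=
      fun hU hu hV hv => (Real.sum_mul_le_sqrt_mul_sqrt s _ _).trans
        (mul_le_mul (hle hU hu).1 (hle hV hv).1 (Real.sqrt_nonneg _) hU)
    calc ∑ i ∈ s, f i ^ 2 ≤ ∑ i ∈ s, (a i + b i + c i) ^ 2 :=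
          Finset.sum_le_sum fun i _ => pow_le_pow_left₀ (hf i) (hfle i) 2
      _ = ∑ i ∈ s, a i ^ 2 + ∑ i ∈ s, b i ^ 2 + ∑ i ∈ s, c i ^ 2 + 2 * ∑ i ∈ s, a i * b i +
          2 * ∑ i ∈ s, a i * c i + 2 * ∑ i ∈ s, b i * c i := by
        simp only [Finset.mul_sum, ← Finset.sum_add_distrib]
        exact Finset.sum_congr rfl fun i _ => by ring
      _ ≤ A ^ 2 + B ^ 2 + C ^ 2 + 2 * (A * B) + 2 * (A * C) + 2 * (B * C) := by
        have := (hle hA ha).2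
        have := (hle hB hb).2
        have := (hle hC hc).2
        have := hmul hA ha hB hb
        have := hmul hA ha hC hc
        have := hmul hB hb hC hc
        linarith
      _ = (A + B + C) ^ 2 := by ring
  have hs : Summable fun i => f i ^ 2 := summable_of_sum_le (fun _ => by positivity) key
  exact ⟨hs, hs.tsum_le_of_sum_le key⟩

/-- The map `(k, i) ↦ (i - k, i)` is an involution of `ℤ × ℤ` that turns the sum into a product of
two independent sums. -/
theorem hasSum_mul_sub {u v : ℤ → ℝ} {U V : ℝ} (hu0 : ∀ m, 0 ≤ u m) (hv0 : ∀ m, 0 ≤ v m)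
    (hu : HasSum u U) (hv : HasSum v V) :
    HasSum (fun q : ℤ × ℤ => u (q.2 - q.1) * v q.2) (U * V) := by
  let e : ℤ × ℤ ≃ ℤ × ℤ :=
    { toFun := fun q => (q.2 - q.1, q.2)
      invFun := fun q => (q.2 - q.1, q.2)
      left_inv := fun q => by ext <;> simp
      right_inv := fun q => by ext <;> simp }
  exact e.hasSum_iff.2 (hu.mul hv (hu.summable.mul_of_nonneg hv.summable hu0 hv0))

theorem hasSum_abs_mul_sq (u v : ℤ → ℝ) {U V : ℝ} (hu : HasSum (fun m => u m ^ 2) (U ^ 2))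
    (hv : HasSum (fun m => v m ^ 2) (V ^ 2)) :
    HasSum (fun q : ℤ × ℤ => (|u (q.2 - q.1)| * v q.2) ^ 2) ((U * V) ^ 2) := by
  simp only [mul_pow, sq_abs]
  exact hasSum_mul_sub (u := fun m => u m ^ 2) (v := fun m => v m ^ 2)
    (fun _ => by positivity) (fun _ => by positivity) hu hv

end Minkowski

/-! ### The localization estimate for general weights -/

section Localization

variable {Y : Type*} [NormedAddCommGroup Y] [NormedSpace ℂ Y]

theorem IsTridiagonal.apply {B : Op Y} (hB : IsTridiagonal B) (x : Ell Y) (i : ℤ) :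
    B x i = entry B i (i - 1) (x (i - 1)) + entry B i i (x i) +
      entry B i (i + 1) (x (i + 1)) := by
  have h := hasSum_sum_of_ne_finset_zero (s := {i - 1, i, i + 1})
    (f := fun j => entry B i j (x j)) (L := .unconditional ℤ) fun j hj => by
      simp only [Finset.mem_insert, Finset.mem_singleton, not_or] at hj
      rw [hB, zero_apply]
      rw [lt_abs]
      push_cast
      omega
  rw [(hasSum_entry B x i).unique h, Finset.sum_insert, Finset.sum_insert, Finset.sum_singleton,
    add_assoc]
  · simp
  · simp
    omega

/-- The sequence `x`, cut off to `k + 1, …, k + n` and weighted by `p (j - k)`. -/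
def weightedCut (p : ℤ → ℝ) (n : ℕ) (k : ℤ) (x : Ell Y) : Ell Y :=
  ∑ j ∈ Finset.Icc (k + 1) (k + n), embed j ((p (j - k) : ℂ) • x j)

theorem weightedCut_apply {p : ℤ → ℝ} {n : ℕ} (hp : ∀ m : ℤ, ¬ (1 ≤ m ∧ m ≤ n) → p m = 0) (k : ℤ)
    (x : Ell Y) (i : ℤ) : weightedCut p n k x i = (p (i - k) : ℂ) • x i := by
  rw [weightedCut, sum_embed_apply _ (fun j => (p (j - k) : ℂ) • x j)]
  split_ifs with h
  · rfl
  · rw [Finset.mem_Icc] at h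
    rw [hp (i - k) (by omega)]
    simp

theorem weightedCut_mem (p : ℤ → ℝ) (n : ℕ) (k : ℤ) (x : Ell Y) :
    weightedCut p n k x ∈ sectionSpace Y n k :=
  mem_sectionSpace.2 fun i hi => by
    rw [weightedCut, sum_embed_apply _ (fun j => (p (j - k) : ℂ) • x j), if_neg hi]

theorem bddAbove_norm_entry (B : Op Y) (f g : ℤ → ℤ) :
    BddAbove (range fun i => ‖entry B (f i) (g i)‖) :=
  ⟨‖B‖, by rintro _ ⟨i, rfl⟩; exact norm_entry_le _ _ _⟩

/-- Write `B` of the weighted sequence as the weighted `B x` plus a commutator. The diagonal entries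
commute with scalar weights, so only the two off-diagonals enter, each with a difference of weights.
-/
theorem norm_apply_weightedCut_le {B : Op Y} (hB : IsTridiagonal B) {p : ℤ → ℝ} {n : ℕ}
    (hp : ∀ m : ℤ, ¬ (1 ≤ m ∧ m ≤ n) → p m = 0) (k i : ℤ) (x : Ell Y) :
    ‖B (weightedCut p n k x) i‖ ≤ |p (i - k)| * ‖B x i‖ +
      |p (i - k + 1) - p (i - k)| * ((⨆ i, ‖entry B i (i + 1)‖) * ‖x (i + 1)‖) +
      |p (i - k - 1) - p (i - k)| * ((⨆ i, ‖entry B i (i - 1)‖) * ‖x (i - 1)‖) := by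
  have h : B (weightedCut p n k x) i = (p (i - k) : ℂ) • B x i +
      ((p (i - k + 1) - p (i - k) : ℝ) : ℂ) • entry B i (i + 1) (x (i + 1)) +
      ((p (i - k - 1) - p (i - k) : ℝ) : ℂ) • entry B i (i - 1) (x (i - 1)) := by
    rw [hB.apply, hB.apply]
    simp only [weightedCut_apply hp, map_smul]
    rw [show i + 1 - k = i - k + 1 by ring, show i - 1 - k = i - k - 1 by ring]
    push_cast
    module
  rw [h]
  refine norm_add₃_le.trans ?_
  simp only [norm_smul, Complex.norm_real, Real.norm_eq_abs]
  gcongr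
  · refine ((entry B i (i + 1)).le_opNorm _).trans ?_
    gcongr
    exact le_ciSup (bddAbove_norm_entry B (fun i => i) (fun i => i + 1)) i
  · refine ((entry B i (i - 1)).le_opNorm _).trans ?_
    gcongr
    exact le_ciSup (bddAbove_norm_entry B (fun i => i) (fun i => i - 1)) i

theorem offDiag_nonneg (B : Op Y) : 0 ≤ offDiag B :=
  add_nonneg (Real.iSup_nonneg fun _ => norm_nonneg _) (Real.iSup_nonneg fun _ => norm_nonneg _)

theorem hasSum_norm_sq_fiberwise {Z : Type*} [NormedAddCommGroup Z] {y : ℤ → Ell Z} {F : ℝ}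
    (h : HasSum (fun q : ℤ × ℤ => ‖y q.1 q.2‖ ^ 2) F) : HasSum (fun k => ‖y k‖ ^ 2) F :=
  HasSum.prod_fiberwise (f := fun q : ℤ × ℤ => ‖y q.1 q.2‖ ^ 2) h fun k => hasSum_norm_sq (y k)

/-- As the window slides over `ℤ`, each coordinate of `x` meets every weight exactly once. -/
theorem hasSum_norm_sq_weightedCut {p : ℤ → ℝ} {n : ℕ}
    (hp : ∀ m : ℤ, ¬ (1 ≤ m ∧ m ≤ n) → p m = 0) {s : ℝ}
    (hps : HasSum (fun m => p m ^ 2) (s ^ 2)) (x : Ell Y) :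
    HasSum (fun k => ‖weightedCut p n k x‖ ^ 2) ((s * ‖x‖) ^ 2) := by
  refine hasSum_norm_sq_fiberwise ?_
  have h : ∀ q : ℤ × ℤ, ‖weightedCut p n q.1 x q.2‖ = |p (q.2 - q.1)| * ‖x q.2‖ := fun q => by
    rw [weightedCut_apply hp, norm_smul, Complex.norm_real, Real.norm_eq_abs]
  simp only [h]
  exact hasSum_abs_mul_sq p (fun i => ‖x i‖) hps (hasSum_norm_sq x)

/-- Apply the bound `c` on each window to the weighted cut of `x`, square, and sum over `k`. The
left side becomes `(c s ‖x‖)²`, and Minkowski over `ℤ × ℤ` bounds the right side by `(s ‖B x‖ + t s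
(a + b) ‖x‖)²`. Here `s` is the ℓ² norm of the weights and `t s` that of their differences. -/
theorem mul_norm_le_of_forall_lowerNormOn {B : Op Y} (hB : IsTridiagonal B) {p : ℤ → ℝ} {n : ℕ}
    (hp : ∀ m : ℤ, ¬ (1 ≤ m ∧ m ≤ n) → p m = 0) {s t : ℝ} (hs : 0 < s) (ht : 0 ≤ t)
    (hps : HasSum (fun m => p m ^ 2) (s ^ 2))
    (hpt : HasSum (fun m => (p (m + 1) - p m) ^ 2) ((t * s) ^ 2)) {c : ℝ} (hc0 : 0 ≤ c)
    (hc : ∀ k, c ≤ lowerNormOn B (sectionSpace Y n k)) (x : Ell Y) :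
    c * ‖x‖ ≤ ‖B x‖ + t * offDiag B * ‖x‖ := by
  set a := ⨆ i, ‖entry B i (i + 1)‖ with ha
  set b := ⨆ i, ‖entry B i (i - 1)‖ with hb
  have ha0 : 0 ≤ a := Real.iSup_nonneg fun _ => norm_nonneg _
  have hb0 : 0 ≤ b := Real.iSup_nonneg fun _ => norm_nonneg _
  have hpt' : HasSum (fun m => (p (m - 1) - p m) ^ 2) ((t * s) ^ 2) := by
    rw [← (Equiv.addRight (1 : ℤ)).hasSum_iff]
    convert hpt using 2 with m
    simp
    ring
  have hx := hasSum_norm_sq x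
  have hxp : HasSum (fun i => ‖x (i + 1)‖ ^ 2) (‖x‖ ^ 2) :=
    (Equiv.addRight (1 : ℤ)).hasSum_iff (f := fun i => ‖x i‖ ^ 2) |>.2 hx
  have hxm : HasSum (fun i => ‖x (i - 1)‖ ^ 2) (‖x‖ ^ 2) :=
    (Equiv.subRight (1 : ℤ)).hasSum_iff (f := fun i => ‖x i‖ ^ 2) |>.2 hx
  obtain ⟨h1, h2⟩ := summable_sq_of_le_add
    (f := fun q : ℤ × ℤ => ‖B (weightedCut p n q.1 x) q.2‖)
    (fun _ => norm_nonneg _) (fun q => norm_apply_weightedCut_le hB hp q.1 q.2 x)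
    (A := s * ‖B x‖) (B := t * s * (a * ‖x‖)) (C := t * s * (b * ‖x‖))
    (by positivity) (by positivity) (by positivity)
    (hasSum_abs_mul_sq p (fun i => ‖B x i‖) hps (hasSum_norm_sq (B x)))
    (hasSum_abs_mul_sq (fun m => p (m + 1) - p m) (fun i => a * ‖x (i + 1)‖) hpt (by
      simpa only [mul_pow] using hxp.mul_left (a ^ 2)))
    (hasSum_abs_mul_sq (fun m => p (m - 1) - p m) (fun i => b * ‖x (i - 1)‖) hpt' (by
      simpa only [mul_pow] using hxm.mul_left (b ^ 2)))
  have h3 := hasSum_norm_sq_fiberwise (y := fun k => B (weightedCut p n k x)) h1.hasSum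
  have h4 := (hasSum_norm_sq_weightedCut hp hps x).mul_left (c ^ 2)
  have hk : ∀ k, c * ‖weightedCut p n k x‖ ≤ ‖B (weightedCut p n k x)‖ := fun k =>
    (mul_le_mul_of_nonneg_right (hc k) (norm_nonneg _)).trans
      (lowerNormOn_mul_norm_le B (sectionSpace Y n k) (weightedCut_mem p n k x))
  have h5 := hasSum_le (fun k => by
    have := pow_le_pow_left₀ (mul_nonneg hc0 (norm_nonneg _)) (hk k) 2
    rwa [mul_pow] at this) h4 h3
  have h6 := h5.trans h2
  rw [← mul_pow, sq_le_sq₀ (by positivity) (by positivity)] at h6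
  refine le_of_mul_le_mul_left ?_ hs
  calc s * (c * ‖x‖) = c * (s * ‖x‖) := by ring
    _ ≤ _ := h6
    _ = s * (‖B x‖ + t * (a + b) * ‖x‖) := by ring

end Localization

/-! ### The sine weights -/

section Weights

/-- The weights `sin (m π / (n + 1))`, `m = 1, …, n`. -/
def sineWeight (n : ℕ) (m : ℤ) : ℝ :=
  if 1 ≤ m ∧ m ≤ n then Real.sin (m * (Real.pi / (n + 1))) else 0

theorem sineWeight_eq_zero {n : ℕ} (m : ℤ) (h : ¬ (1 ≤ m ∧ m ≤ n)) : sineWeight n m = 0 :=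
  if_neg h

/-- The formula persists at `0` and `n + 1`, where the sine vanishes. Hence it covers both
neighbours of every `m` in the support. -/
theorem sineWeight_eq_sin {n : ℕ} {m : ℤ} (h0 : 0 ≤ m) (h1 : m ≤ n + 1) :
    sineWeight n m = Real.sin (m * (Real.pi / (n + 1))) := by
  unfold sineWeight
  split_ifs with h
  · rfl
  · obtain rfl | rfl : m = 0 ∨ m = n + 1 := by omega
    · simp
    · have : (n : ℝ) + 1 ≠ 0 := by positivity
      push_cast
      rw [mul_div_cancel₀ _ this, Real.sin_pi]

theorem summable_sineWeight_mul (n : ℕ) (f : ℤ → ℝ) :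
    Summable fun m => sineWeight n m * f m :=
  summable_of_ne_finset_zero (s := Finset.Icc 1 (n : ℤ)) fun m hm => by
    rw [sineWeight_eq_zero m (by simpa using hm), zero_mul]

/-- The addition formulas make the sine an eigenvector of the sum of the two shifts. The factor
`sineWeight n m` kills the points outside the window, since the bare recurrence fails at `0` and `n
+ 1`. -/
theorem sineWeight_recurrence (n : ℕ) (m : ℤ) :
    sineWeight n m * (sineWeight n (m + 1) + sineWeight n (m - 1)) =
      sineWeight n m * (2 * Real.cos (Real.pi / (n + 1)) * sineWeight n m) := by
  by_cases h : 1 ≤ m ∧ m ≤ n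
  · rw [sineWeight_eq_sin (m := m + 1) (by omega) (by omega),
      sineWeight_eq_sin (m := m - 1) (by omega) (by omega),
      sineWeight_eq_sin (m := m) (by omega) (by omega)]
    push_cast
    rw [add_mul, sub_mul, one_mul, Real.sin_add, Real.sin_sub]
    ring
  · rw [sineWeight_eq_zero m h, zero_mul, zero_mul]

theorem hasSum_sineWeight_sq (n : ℕ) :
    HasSum (fun m => sineWeight n m ^ 2) (√(∑' m, sineWeight n m ^ 2) ^ 2) := by
  rw [Real.sq_sqrt (tsum_nonneg fun _ => by positivity)]
  simpa only [sq] using (summable_sineWeight_mul n (sineWeight n)).hasSum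

theorem sqrt_tsum_sineWeight_pos {n : ℕ} (hn : 1 ≤ n) : 0 < √(∑' m, sineWeight n m ^ 2) := by
  have hn' : (1 : ℝ) ≤ n := by exact_mod_cast hn
  have h1 : 0 < sineWeight n 1 := by
    rw [sineWeight_eq_sin (by omega) (by omega)]
    refine Real.sin_pos_of_pos_of_lt_pi (by positivity) ?_
    rw [Int.cast_one, one_mul]
    exact div_lt_self Real.pi_pos (by linarith)
  refine Real.sqrt_pos.2 ?_
  have := (hasSum_sineWeight_sq n).summable
  exact this.tsum_pos (fun _ => by positivity) 1 (by positivity)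

/-- The sum equals `2S - 2C`, where `C` is the correlation of the weights with their shift. The
recurrence gives `C = cos (π/(n+1)) S`, and `2 - 2 cos θ = 4 sin² (θ/2)`. -/
theorem hasSum_sineWeight_diff_sq (n : ℕ) :
    HasSum (fun m => (sineWeight n (m + 1) - sineWeight n m) ^ 2)
      ((2 * Real.sin (Real.pi / (2 * ((n : ℝ) + 1))) * √(∑' m, sineWeight n m ^ 2)) ^ 2) := by
  set S := √(∑' m, sineWeight n m ^ 2) ^ 2 with hS
  set w := sineWeight n
  have h0 : HasSum (fun m => w m ^ 2) S := hasSum_sineWeight_sq n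
  have h1 : HasSum (fun m => w (m + 1) ^ 2) S :=
    (Equiv.addRight (1 : ℤ)).hasSum_iff (f := fun i => w i ^ 2) |>.2 h0
  obtain ⟨C, hC⟩ := summable_sineWeight_mul n (fun m => w (m + 1))
  have hC' : HasSum (fun m => w m * w (m - 1)) C := by
    rw [← (Equiv.addRight (1 : ℤ)).hasSum_iff]
    convert! hC using 2 with m
    simp [w, mul_comm]
  have h2 : 2 * C = 2 * Real.cos (Real.pi / (n + 1)) * S := by
    have h3 := hC.add hC'
    have h4 := h0.mul_left (2 * Real.cos (Real.pi / (n + 1)))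
    have h5 : (fun m => w m * w (m + 1) + w m * w (m - 1)) =
        fun m => 2 * Real.cos (Real.pi / (n + 1)) * w m ^ 2 := by
      funext m
      rw [← mul_add, sineWeight_recurrence]
      ring
    change HasSum (fun m => w m * w (m + 1) + w m * w (m - 1)) _ at h3
    rw [h5] at h3
    linarith [h3.unique h4]
  have h6 := (h1.add h0).sub (hC.mul_left 2)
  have h7 : S + S - 2 * C =
      (2 * Real.sin (Real.pi / (2 * ((n : ℝ) + 1))) * √(∑' m, w m ^ 2)) ^ 2 := by
    rw [h2, mul_pow, ← hS, mul_pow, Real.sin_sq_eq_half_sub]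
    rw [show 2 * (Real.pi / (2 * ((n : ℝ) + 1))) = Real.pi / (n + 1) by
      field_simp]
    ring
  rw [← h7]
  convert! h6 using 2 with m
  simp only [w]
  ring

end Weights

/-! ### The localization estimate with the penalty term -/

section Localization

variable {Y : Type*} [NormedAddCommGroup Y] [NormedSpace ℂ Y]

theorem sin_pi_div_nonneg (n : ℕ) : 0 ≤ Real.sin (Real.pi / (2 * ((n : ℝ) + 1))) := by
  refine Real.sin_nonneg_of_nonneg_of_le_pi (by positivity) ?_
  have : (0 : ℝ) ≤ n := by positivity
  exact div_le_self Real.pi_pos.le (by linarith)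

theorem penalty_nonneg (n : ℕ) (B : Op Y) : 0 ≤ penalty n B :=
  mul_nonneg (mul_nonneg zero_le_two (offDiag_nonneg B)) (sin_pi_div_nonneg n)

/-- The lower norm of a tridiagonal operator is approximated by those of its restrictions to the
`E_{n,k}`, up to the penalty term. -/
theorem le_lowerNorm_add_penalty [Nontrivial (Ell Y)] {B : Op Y} (hB : IsTridiagonal B) {n : ℕ}
    (hn : 1 ≤ n) {c : ℝ} (hc : ∀ k, c ≤ lowerNormOn B (sectionSpace Y n k)) :
    c ≤ lowerNorm B + penalty n B := by
  -- The estimate squares `c`, so it needs `c ≥ 0`. For negative `c` the right side is already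
  -- non-negative.
  rcases lt_or_ge c 0 with h | h
  · linarith [lowerNorm_nonneg B, penalty_nonneg n B]
  rw [← sub_le_iff_le_add]
  refine le_lowerNorm fun x => ?_
  have := mul_norm_le_of_forall_lowerNormOn hB sineWeight_eq_zero (sqrt_tsum_sineWeight_pos hn)
    (mul_nonneg zero_le_two (sin_pi_div_nonneg n))
    (hasSum_sineWeight_sq n) (hasSum_sineWeight_diff_sq n) h hc x
  rw [penalty]
  linarith

/-- Transposition swaps the super- and subdiagonal, hence the `add_comm` and the shifts of the index
by one. -/
theorem offDiag_transpose_le (B : Op Y) : offDiag (transpose B) ≤ offDiag B := by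
  rw [offDiag, offDiag, add_comm]
  refine add_le_add (ciSup_le fun i => ?_) (ciSup_le fun i => ?_)
  · rw [entry_transpose]
    refine (norm_dual_le _).trans ?_
    simpa using le_ciSup (bddAbove_norm_entry B (fun i => i) (fun i => i + 1)) (i - 1)
  · rw [entry_transpose]
    refine (norm_dual_le _).trans ?_
    simpa using le_ciSup (bddAbove_norm_entry B (fun i => i) (fun i => i - 1)) (i + 1)

theorem offDiag_subScalar (B : Op Y) (z : ℂ) : offDiag (subScalar B z) = offDiag B := by
  have h : ∀ i : ℤ, i ≠ i - 1 := fun i => by omega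
  simp [offDiag, entry_subScalar, h]

theorem offDiag_le (B : Op Y) : offDiag B ≤ 2 * ‖B‖ := by
  rw [two_mul]
  exact add_le_add (ciSup_le fun i => norm_entry_le _ _ _) (ciSup_le fun i => norm_entry_le _ _ _)

theorem penalty_mono {Y' : Type*} [NormedAddCommGroup Y'] [NormedSpace ℂ Y'] {B : Op Y}
    {B' : Op Y'} (n : ℕ) (h : offDiag B ≤ offDiag B') : penalty n B ≤ penalty n B' := by
  have := sin_pi_div_nonneg n
  unfold penalty
  gcongr

end Localization


/-! ### Regrouping into blocks -/

section Regroup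

variable {X : Type*} [NormedAddCommGroup X] [NormedSpace ℂ X]

theorem regroup_blockIso (b : ℕ) [NeZero b] (B : Op X) (x : Ell X) :
    regroup b B (blockIso X b x) = blockIso X b (B x) := by
  change blockIso X b (B ((blockIso X b).symm (blockIso X b x))) = _
  rw [(blockIso X b).symm_apply_apply]

theorem norm_regroup_le (b : ℕ) [NeZero b] (B : Op X) : ‖regroup b B‖ ≤ ‖B‖ :=
  ContinuousLinearMap.opNorm_le_bound _ (norm_nonneg _) fun ξ => by
    obtain ⟨x, rfl⟩ := (blockIso X b).surjective ξ
    rw [regroup_blockIso, (blockIso X b).norm_map, (blockIso X b).norm_map]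
    exact B.le_opNorm x

theorem recipNormInv_subScalar_regroup (b : ℕ) [NeZero b] (B : Op X) (z : ℂ) :
    recipNormInv (subScalar (regroup b B) z) = recipNormInv (subScalar B z) :=
  recipNormInv_conj (blockIso X b) fun x => by
    rw [subScalar_apply, subScalar_apply, regroup_blockIso, map_sub, map_smul]

theorem blockIso_symm_embed (b : ℕ) [NeZero b] (j : ℤ) (ξ : Pow X b) :
    (blockIso X b).symm (embed j ξ) = ∑ m, embed (blockIndex b (j, m)) (ξ m) := by
  ext i
  obtain ⟨⟨i', m'⟩, rfl⟩ := (blockIndex b).surjective i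
  have h1 : (blockIso X b).symm (embed j ξ) (blockIndex b (i', m')) = (embed j ξ : Ell _) i' m' := by
    change (embed j ξ : Ell _) ((blockIndex b).symm (blockIndex b (i', m'))).1
      ((blockIndex b).symm (blockIndex b (i', m'))).2 = _
    rw [Equiv.symm_apply_apply]
  rw [h1, embed_apply, ← coord_apply (blockIndex b (i', m')), map_sum]
  simp only [coord_apply, embed_apply, (blockIndex b).injective.eq_iff, Prod.mk.injEq]
  by_cases h : i' = j <;> simp [h]

theorem entry_regroup (b : ℕ) [NeZero b] (B : Op X) (i j : ℤ) :
    entry (regroup b B) i j =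
      ofEntries fun m m' => entry B (blockIndex b (i, m)) (blockIndex b (j, m')) := by
  ext ξ m
  rw [ofEntries_apply, entry_apply]
  change blockIso X b (B ((blockIso X b).symm (embed j ξ))) i m = _
  rw [blockIso_symm_embed, map_sum]
  change (∑ m', B (embed (blockIndex b (j, m')) (ξ m'))) (blockIndex b (i, m)) = _
  rw [← coord_apply, map_sum]
  rfl

/-- Indices from blocks that are at least two apart differ by at least `2b - (b - 1) = b + 1`, which
exceeds the band-width. -/
theorem isTridiagonal_regroup (b : ℕ) [NeZero b] {B : Op X} (hB : HasBandwidth B b) :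
    IsTridiagonal (regroup b B) := by
  intro i j hij
  rw [entry_regroup]
  ext ξ m
  rw [ofEntries_apply]
  refine Finset.sum_eq_zero fun m' _ => ?_
  rw [hB, zero_apply]
  rw [blockIndex_apply, blockIndex_apply, lt_abs]
  have h1 := m.2
  have h2 := m'.2
  rw [lt_abs] at hij
  rcases hij with h | h
  · left
    have : (b : ℤ) * 2 ≤ b * (i - j) := by gcongr; push_cast at h; omega
    rw [mul_sub] at this
    omega
  · right
    have : (b : ℤ) * 2 ≤ b * (j - i) := by gcongr; push_cast at h; omega
    rw [mul_sub] at this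
    omega

end Regroup

/-! ### Finite nets of truncations -/

section Net

variable {Y : Type*} [NormedAddCommGroup Y] [NormedSpace ℂ Y]

/-- A finite sum of compositions, in which continuity in the entries for the operator norm is
visible. -/
theorem ofEntries_eq_sum {m n : ℕ} (M : Fin m → Fin n → (Y →L[ℂ] Y)) :
    ofEntries M = ∑ r, ∑ c,
      ((PiLp.continuousLinearEquiv 2 ℂ (fun _ : Fin m => Y)).symm.toContinuousLinearMap ∘L
        ContinuousLinearMap.single ℂ (fun _ : Fin m => Y) r) ∘L
        (M r c ∘L PiLp.proj (𝕜 := ℂ) 2 (fun _ : Fin n => Y) c) := by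
  ext ξ i
  rw [ofEntries_apply]
  simp only [sum_apply, ContinuousLinearMap.comp_apply, WithLp.ofLp_sum, Finset.sum_apply]
  rw [Finset.sum_eq_single i]
  · simp
  · intro r _ hr
    simp [hr.symm]
  · simp

theorem continuous_ofEntries {m n : ℕ} :
    Continuous fun M : Fin m → Fin n → (Y →L[ℂ] Y) => ofEntries M := by
  simp only [ofEntries_eq_sum]
  refine continuous_finsetSum _ fun r _ => continuous_finsetSum _ fun c _ => ?_
  exact continuous_const.clm_comp
    (((continuous_apply c).comp (continuous_apply r)).clm_comp continuous_const)

theorem dist_eq_norm_sub {V W : Type*} [NormedAddCommGroup V] [NormedSpace ℂ V]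
    [NormedAddCommGroup W] [NormedSpace ℂ W] (B C : V →L[ℂ] W) : dist B C = ‖B - C‖ :=
  dist_eq_norm B C

theorem continuous_dual {V W : Type*} [NormedAddCommGroup V] [NormedSpace ℂ V]
    [NormedAddCommGroup W] [NormedSpace ℂ W] : Continuous fun B : V →L[ℂ] W => dual B :=
  ((ContinuousLinearMap.compL ℂ V W ℂ).flip).continuous

theorem isCompact_entries {m n : ℕ} {C : Set (Y →L[ℂ] Y)} (hC : IsCompact C) :
    IsCompact {M : Fin m → Fin n → (Y →L[ℂ] Y) | ∀ r c, M r c ∈ C} :=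
  isCompact_pi_infinite (s := fun _ => {f : Fin n → (Y →L[ℂ] Y) | ∀ c, f c ∈ C})
    fun _ => isCompact_pi_infinite fun _ => hC

theorem exists_finset_dist_lt {ι α : Type*} [PseudoMetricSpace α] {f : ι → α} {D : Set α}
    (hD : IsCompact D) (hf : ∀ i, f i ∈ D) {r : ℝ} (hr : 0 < r) :
    ∃ K : Finset ι, ∀ k, ∃ j ∈ K, dist (f k) (f j) < r := by
  classical
  have htb : TotallyBounded (range f) := hD.totallyBounded.subset (range_subset_iff.2 hf)
  -- The centres are taken in the range of `f`, so that they come from indices.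
  obtain ⟨t, ht, htf, hcov⟩ := Metric.finite_approx_of_totallyBounded htb r hr
  lift t to Finset α using htf
  rw [← image_univ, Finset.subset_set_image_iff] at ht
  obtain ⟨K, -, rfl⟩ := ht
  refine ⟨K, fun k => ?_⟩
  have := hcov (mem_range_self k)
  simp only [Finset.coe_image, mem_image, mem_iUnion, Metric.mem_ball, exists_prop] at this
  obtain ⟨_, ⟨j, hj, rfl⟩, hd⟩ := this
  exact ⟨j, hj, hd⟩

/-- Both truncations at `k` are continuous functions of one `(n + 2) × (n + 2)` window of entries,
and the windows stay in a compact set. A net for the pair therefore serves both at once. -/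
theorem exists_isNet {B : Op Y} {C : Set (Y →L[ℂ] Y)} (hC : IsCompact C)
    (hB : ∀ i j, entry B i j ∈ C) {n : ℕ} (hn : 1 ≤ n) : ∃ K : Finset ℤ, IsNet n K B := by
  let Φ : (Fin (n + 2) → Fin (n + 2) → (Y →L[ℂ] Y)) →
      (Pow Y n →L[ℂ] Pow Y (n + 2)) ×
        (Pow (StrongDual ℂ Y) n →L[ℂ] Pow (StrongDual ℂ Y) (n + 2)) := fun M =>
    -- The window starts at `k`, whereas the columns start at `k + 1`, hence the shift by `succ`.
    (ofEntries fun r c => M r c.succ.castSucc, ofEntries fun r c => dual (M c.succ.castSucc r))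
  have hΦ : Continuous Φ := by
    refine Continuous.prodMk (continuous_ofEntries.comp ?_) (continuous_ofEntries.comp ?_)
    · fun_prop
    · refine continuous_pi fun r => continuous_pi fun c => continuous_dual.comp ?_
      fun_prop
  let f : ℤ → _ := fun k => (truncPlus n k B, truncPlusDual n k B)
  have hf : ∀ k, f k = Φ fun r c => entry B (k + (r : ℕ)) (k + (c : ℕ)) := fun k => by
    have h : ∀ c : Fin n, k + 1 + ((c : ℕ) : ℤ) = k + ((c.succ.castSucc : Fin (n + 2)) : ℕ) :=
      fun c => by
        rw [Fin.val_castSucc, Fin.val_succ]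
        push_cast
        ring
    simp only [f, Φ, truncPlus, truncPlusDual, h]
  obtain ⟨K, hK⟩ := exists_finset_dist_lt ((isCompact_entries hC).image hΦ) (f := f)
    (fun k => ⟨_, fun r c => hB _ _, (hf k).symm⟩)
    (one_div_pos.2 (Nat.cast_pos.2 hn) : 0 < 1 / (n : ℝ))
  refine ⟨K, fun k => ?_⟩
  obtain ⟨j, hj, hd⟩ := hK k
  rw [Prod.dist_eq, max_lt_iff, dist_eq_norm_sub, dist_eq_norm_sub] at hd
  exact ⟨j, hj, hd.1.le, hd.2.le⟩

/-- The entries of `A^{(n)}` are those of `A` times factors in `[0, 1]`, so they lie in the image of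
a compact product. The blocks are continuous images of finite arrays of such entries. -/
theorem exists_isNet_regroup {X : Type*} [NormedAddCommGroup X] [NormedSpace ℂ X] {A : Op X}
    (hcomp : IsCompact (closure {a : X →L[ℂ] X | ∃ i j : ℤ, a = entry A i j}))
    {An : ℕ → Op X} (hAn : IsBandedApprox A An) (b : ℕ) [NeZero b] {n : ℕ} (hn : 1 ≤ n) :
    ∃ K : Finset ℤ, IsNet n K (regroup b (An n)) := by
  have hC := (isCompact_Icc (a := (0 : ℝ)) (b := 1)).prod hcomp |>.image
    (f := fun q : ℝ × (X →L[ℂ] X) => (q.1 : ℂ) • q.2) (by fun_prop)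
  have hA : ∀ i j, entry A i j ∈ closure {a : X →L[ℂ] X | ∃ i j : ℤ, a = entry A i j} :=
    fun i j => subset_closure ⟨i, j, rfl⟩
  have hent : ∀ i j, entry (An n) i j ∈ (fun q : ℝ × (X →L[ℂ] X) => (q.1 : ℂ) • q.2) ''
      (Icc (0 : ℝ) 1 ×ˢ closure {a : X →L[ℂ] X | ∃ i j : ℤ, a = entry A i j}) := by
    intro i j
    rcases hAn with ⟨-, h⟩ | ⟨-, p, hp, h⟩
    · exact ⟨(1, entry A i j), ⟨by simp, hA i j⟩, by simp [h n hn]⟩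
    · rw [h n hn]
      split_ifs with hij
      · have h0 : (0 : ℝ) ≤ 1 - ((|i - j| : ℤ) : ℝ) / ((n : ℝ) + 1) := by
          have : ((|i - j| : ℤ) : ℝ) ≤ n := by exact_mod_cast hij
          rw [sub_nonneg, div_le_one (by positivity)]
          linarith
        have h1 : 1 - ((|i - j| : ℤ) : ℝ) / ((n : ℝ) + 1) ≤ 1 := by
          have : (0 : ℝ) ≤ ((|i - j| : ℤ) : ℝ) := by exact_mod_cast abs_nonneg _
          rw [sub_le_self_iff]
          positivity
        exact ⟨(_, entry A i j), ⟨⟨Real.rpow_nonneg h0 p, Real.rpow_le_one h0 h1 hp⟩, hA i j⟩, rfl⟩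
      · exact ⟨(0, entry A i j), ⟨by simp, hA i j⟩, by simp⟩
  refine exists_isNet ((isCompact_entries (m := b) (n := b) hC).image continuous_ofEntries)
    (fun i j => ⟨_, fun m m' => hent _ _, (entry_regroup b (An n) i j).symm⟩) hn

end Net


/-! ### Non-trivial spaces -/

section Nontriviality

variable {Y : Type*} [NormedAddCommGroup Y] [NormedSpace ℂ Y]

theorem nontrivial_pow {Y : Type*} [NormedAddCommGroup Y] [Nontrivial Y] {n : ℕ}
    (hn : 1 ≤ n) : Nontrivial (Pow Y n) := by
  obtain ⟨y, hy⟩ := exists_ne (0 : Y)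
  refine ⟨WithLp.toLp 2 fun _ => y, 0, fun h => hy ?_⟩
  simpa using congr($h ⟨0, hn⟩)

theorem nontrivial_ell [Nontrivial Y] : Nontrivial (Ell Y) := by
  obtain ⟨y, hy⟩ := exists_ne (0 : Y)
  refine ⟨embed 0 y, 0, fun h => hy ?_⟩
  rw [← norm_eq_zero, ← norm_embed 0 y, h, norm_zero]

theorem nontrivial_sectionSpace [Nontrivial Y] {n : ℕ} (hn : 1 ≤ n) (k : ℤ) :
    Nontrivial (sectionSpace Y n k) :=
  have := nontrivial_pow (Y := Y) hn
  (sectionIso Y n k).toEquiv.nontrivial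

end Nontriviality

/-! ### Comparing `muFin` with the norm of the inverse -/

section MuFin

variable {Y : Type*} [NormedAddCommGroup Y] [NormedSpace ℂ Y]

theorem IsNet.nonempty {n : ℕ} {K : Finset ℤ} {B : Op Y} (hK : IsNet n K B) : K.Nonempty := by
  obtain ⟨j, hj, -⟩ := hK 0
  exact ⟨j, hj⟩

/-- Restriction can only raise a lower norm. `K` must be non-empty because a real infimum over an
empty type is `0`. -/
theorem recipNormInv_le_muFin [CompleteSpace Y] [Nontrivial Y] {n : ℕ} (hn : 1 ≤ n)
    {K : Finset ℤ} (hK : K.Nonempty) (B : Op Y) : recipNormInv B ≤ muFin n K B := by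
  have := nontrivial_strongDual Y
  have := nontrivial_ell (Y := Y)
  have : Nonempty {k : ℤ // k ∈ K} := hK.to_subtype
  refine le_ciInf fun k => ?_
  have h1 := nontrivial_sectionSpace (Y := Y) hn k
  have h2 := nontrivial_sectionSpace (Y := StrongDual ℂ Y) hn k
  rw [recipNormInv_eq_min, lowerNormOn_dual, ← lowerNorm_transpose]
  exact min_le_min (lowerNorm_le_lowerNormOn _ _) (lowerNorm_le_lowerNormOn _ _)

theorem muFinMat_le {n : ℕ} {K : Finset ℤ} {B : Op Y} {z : ℂ} {j : ℤ} (hj : j ∈ K) :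
    muFinMat n K B z ≤ min (lowerNorm (truncPlus n j B - z • idPlus Y n))
      (lowerNorm (truncPlusDual n j B - z • idPlus (StrongDual ℂ Y) n)) :=
  ciInf_le (f := fun j : {j : ℤ // j ∈ K} => min (lowerNorm (truncPlus n j B - z • idPlus Y n))
      (lowerNorm (truncPlusDual n j B - z • idPlus (StrongDual ℂ Y) n)))
    (Set.finite_range _).bddBelow ⟨j, hj⟩

/-- The net extends the bound from `k ∈ K` to all `k` at the cost `1/n`. Then the localization
estimate is applied to `B - λ` and to its transpose, whose penalties are at most that of `B`. -/
theorem muFin_subScalar_le [CompleteSpace Y] [Nontrivial Y] {B : Op Y} (hB : IsTridiagonal B)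
    {n : ℕ} (hn : 1 ≤ n) {K : Finset ℤ} (hK : IsNet n K B) (z : ℂ) :
    muFin n K (subScalar B z) ≤ recipNormInv (subScalar B z) + penalty n B + 1 / (n : ℝ) := by
  have := nontrivial_strongDual Y
  have := nontrivial_ell (Y := Y)
  have := nontrivial_ell (Y := StrongDual ℂ Y)
  have := nontrivial_pow (Y := Y) hn
  have := nontrivial_pow (Y := StrongDual ℂ Y) hn
  have hBz : IsTridiagonal (subScalar B z) := hB.subScalar z
  have h1 : ∀ k, muFin n K (subScalar B z) - 1 / (n : ℝ) ≤
      lowerNormOn (subScalar B z) (sectionSpace Y n k) := fun k => by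
    obtain ⟨j, hj, hkj, -⟩ := hK k
    rw [muFin_subScalar hB, lowerNormOn_sectionSpace hBz, truncPlus_subScalar]
    have h2 := (muFinMat_le (n := n) (B := B) (z := z) hj).trans (min_le_left _ _)
    have h3 := lowerNorm_sub_le (truncPlus n j B - z • idPlus Y n)
      (truncPlus n k B - z • idPlus Y n)
    -- The multiples of `idPlus` cancel, so one net works for all `λ`.
    rw [sub_sub_sub_cancel_right, norm_sub_rev] at h3
    linarith
  have h1' : ∀ k, muFin n K (subScalar B z) - 1 / (n : ℝ) ≤
      lowerNormOn (transpose (subScalar B z)) (sectionSpace (StrongDual ℂ Y) n k) := fun k => by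
    obtain ⟨j, hj, -, hkj⟩ := hK k
    rw [muFin_subScalar hB, lowerNormOn_sectionSpace hBz.transpose, transpose_subScalar,
      truncPlus_subScalar, ← truncPlusDual_eq]
    have h2 := (muFinMat_le (n := n) (B := B) (z := z) hj).trans (min_le_right _ _)
    have h3 := lowerNorm_sub_le (truncPlusDual n j B - z • idPlus (StrongDual ℂ Y) n)
      (truncPlusDual n k B - z • idPlus (StrongDual ℂ Y) n)
    rw [sub_sub_sub_cancel_right, norm_sub_rev] at h3
    linarith
  have h4 := le_lowerNorm_add_penalty hBz hn h1
  have h4' := le_lowerNorm_add_penalty hBz.transpose hn h1'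
  have h5 := penalty_mono n (offDiag_subScalar B z).le
  have h5' := penalty_mono n ((offDiag_transpose_le _).trans (offDiag_subScalar B z).le)
  rw [lowerNorm_transpose] at h4'
  rw [recipNormInv_eq_min]
  have h6 : muFin n K (subScalar B z) - 1 / (n : ℝ) - penalty n B ≤
      min (lowerNorm (subScalar B z)) (lowerNorm (dual (subScalar B z))) :=
    le_min (by linarith) (by linarith)
  linarith

end MuFin

/-! ### Pseudospectra as compact sublevel sets -/

section Pseudospectrum

variable {V : Type*} [NormedAddCommGroup V] [NormedSpace ℂ V] [Nontrivial V]

/-- This absorbs the convention for `ε = 0`: `recipNormInv` is positive on invertible operators and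
`0` otherwise. -/
theorem mem_pseudospectrum_iff {ε : ℝ} (hε : 0 ≤ ε) (A : V →L[ℂ] V) (z : ℂ) :
    z ∈ pseudospectrum ε A ↔ recipNormInv (subScalar A z) ≤ ε := by
  unfold pseudospectrum
  split_ifs with h
  · subst h
    have h1 : z ∈ spectrum ℂ A ↔ ¬ IsUnit (subScalar A z) := by
      rw [spectrum.mem_iff, IsUnit.sub_iff]
      rfl
    rw [h1]
    constructor
    · intro hu
      rw [recipNormInv, if_neg hu]
    · intro hle hu
      exact (recipNormInv_pos hu).not_ge hle
  · rfl

variable [CompleteSpace V]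

theorem recipNormInv_subScalar_le (A B : V →L[ℂ] V) (z : ℂ) :
    recipNormInv (subScalar A z) ≤ recipNormInv (subScalar B z) + ‖A - B‖ := by
  have := recipNormInv_sub_le (subScalar A z) (subScalar B z)
  rw [subScalar, subScalar, sub_sub_sub_cancel_right] at this
  rw [subScalar, subScalar]
  linarith

theorem continuous_recipNormInv_subScalar (A : V →L[ℂ] V) :
    Continuous fun z => recipNormInv (subScalar A z) := by
  refine (LipschitzWith.of_le_add_mul (1 : NNReal) fun z z' => ?_).continuous
  have h := recipNormInv_sub_le (subScalar A z) (subScalar A z')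
  have h2 : subScalar A z - subScalar A z' = (z' - z) • ContinuousLinearMap.id ℂ V := by
    rw [subScalar, subScalar, sub_smul]
    abel
  rw [h2, norm_smul] at h
  have h3 : ‖z' - z‖ * ‖ContinuousLinearMap.id ℂ V‖ ≤ ‖z' - z‖ * 1 := by
    gcongr
    exact ContinuousLinearMap.norm_id_le
  rw [NNReal.coe_one, one_mul, dist_comm, dist_eq_norm]
  linarith

theorem norm_sub_le_recipNormInv_subScalar (A : V →L[ℂ] V) (z : ℂ) :
    ‖z‖ - ‖A‖ ≤ recipNormInv (subScalar A z) := by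
  have := nontrivial_strongDual V
  rw [recipNormInv_eq_min, dual_subScalar]
  have key : ∀ {W : Type _} [NormedAddCommGroup W] [NormedSpace ℂ W] [Nontrivial W]
      (C : W →L[ℂ] W), ‖C‖ ≤ ‖A‖ → ‖z‖ - ‖A‖ ≤ lowerNorm (subScalar C z) := by
    intro W _ _ _ C hC
    refine le_lowerNorm fun x => ?_
    have h1 : ‖z • x‖ ≤ ‖C x - z • x‖ + ‖C x‖ := by
      rw [norm_sub_rev]
      simpa using norm_add_le (z • x - C x) (C x)
    rw [norm_smul] at h1
    have h2 := C.le_of_opNorm_le hC x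
    rw [subScalar_apply]
    linarith
  exact le_min (key A le_rfl) (key (dual A) (norm_dual_le A))

theorem isCompact_pseudospectrum {ε : ℝ} (hε : 0 ≤ ε) (A : V →L[ℂ] V) :
    IsCompact (pseudospectrum ε A) := by
  refine Metric.isCompact_of_isClosed_isBounded ?_ ?_
  · have : pseudospectrum ε A = {z | recipNormInv (subScalar A z) ≤ ε} := by
      ext z; exact mem_pseudospectrum_iff hε A z
    rw [this]
    exact isClosed_le (continuous_recipNormInv_subScalar A) continuous_const
  · refine (isBounded_iff_forall_norm_le).2 ⟨‖A‖ + ε, fun z hz => ?_⟩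
    have h1 := norm_sub_le_recipNormInv_subScalar A z
    have h2 := (mem_pseudospectrum_iff hε A z).1 hz
    linarith

theorem pseudospectrum_nonempty {ε : ℝ} (hε : 0 ≤ ε) (A : V →L[ℂ] V) :
    (pseudospectrum ε A).Nonempty := by
  obtain ⟨z, hz⟩ := spectrum.nonempty (A : V →L[ℂ] V)
  have hz' : z ∈ pseudospectrum 0 A := by rwa [pseudospectrum, if_pos rfl]
  exact ⟨z, (mem_pseudospectrum_iff hε A z).2 (((mem_pseudospectrum_iff le_rfl A z).1 hz').trans hε)⟩

/-- The pseudospectra depend continuously on `ε` from the right. -/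
theorem exists_pseudospectrum_subset_thickening {ε : ℝ} (hε : 0 ≤ ε) (A : V →L[ℂ] V) {ρ : ℝ}
    (hρ : 0 < ρ) :
    ∃ τ > 0, pseudospectrum (ε + τ) A ⊆ Metric.thickening ρ (pseudospectrum ε A) := by
  -- On this compact remainder the continuous function attains its minimum, which exceeds `ε`.
  have hcomp : IsCompact (pseudospectrum (ε + 1) A \ Metric.thickening ρ (pseudospectrum ε A)) :=
    (isCompact_pseudospectrum (by linarith) A).diff Metric.isOpen_thickening
  rcases (pseudospectrum (ε + 1) A \ Metric.thickening ρ (pseudospectrum ε A)).eq_empty_or_nonempty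
    with h | h
  · exact ⟨1, one_pos, sdiff_eq_empty.1 h⟩
  obtain ⟨z, hz, hmin⟩ := hcomp.exists_isMinOn h (continuous_recipNormInv_subScalar A).continuousOn
  have hlt : ε < recipNormInv (subScalar A z) := by
    by_contra! hc
    exact hz.2 (Metric.self_subset_thickening hρ _ ((mem_pseudospectrum_iff hε A z).2 hc))
  -- Half the gap keeps `ε + τ` below that minimum, and the cap `1` keeps the set inside `Spec_{ε+1}
  -- A`.
  refine ⟨min 1 ((recipNormInv (subScalar A z) - ε) / 2), lt_min one_pos (by linarith), ?_⟩
  intro y hy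
  have hτ : 0 ≤ ε + min 1 ((recipNormInv (subScalar A z) - ε) / 2) :=
    add_nonneg hε (le_min zero_le_one (by linarith))
  rw [mem_pseudospectrum_iff hτ] at hy
  by_contra hy'
  have hmem : y ∈ pseudospectrum (ε + 1) A := by
    rw [mem_pseudospectrum_iff (by linarith)]
    exact hy.trans (by gcongr; exact min_le_left _ _)
  have h1 : recipNormInv (subScalar A z) ≤ recipNormInv (subScalar A y) := hmin ⟨hmem, hy'⟩
  have h2 := min_le_right 1 ((recipNormInv (subScalar A z) - ε) / 2)
  linarith

/-- One half of the Hausdorff distance vanishes by inclusion. The other is controlled by continuity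
from the right in `ε`. -/
theorem hausdorffTendsto_pseudospectrum {ε : ℝ} (hε : 0 ≤ ε) (A : V →L[ℂ] V) {S : ℕ → Set ℂ}
    {τ : ℕ → ℝ} (hτ0 : ∀ n, 1 ≤ n → 0 ≤ τ n) (hτ : Tendsto τ atTop (𝓝 0))
    (hS : ∀ n, 1 ≤ n → pseudospectrum ε A ⊆ S n)
    (hS' : ∀ n, 1 ≤ n → S n ⊆ pseudospectrum (ε + τ n) A) :
    HausdorffTendsto S (pseudospectrum ε A) := by
  have hT := pseudospectrum_nonempty hε A
  refine ⟨fun n hn => ⟨?_, hT.mono (hS n hn)⟩, (isCompact_pseudospectrum hε A).isBounded, hT, ?_⟩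
  · exact (isCompact_pseudospectrum (add_nonneg hε (hτ0 n hn)) A).isBounded.subset (hS' n hn)
  rw [ENNReal.tendsto_nhds_zero]
  intro r hr
  rcases eq_or_ne r ⊤ with rfl | hr'
  · simp
  obtain ⟨σ, hσ, hsub⟩ := exists_pseudospectrum_subset_thickening hε A
    (ENNReal.toReal_pos hr.ne' hr')
  filter_upwards [hτ.eventually_lt_const hσ, eventually_ge_atTop 1] with n hn h1
  refine Metric.hausdorffEDist_le_of_infEDist (fun z hz => ?_) fun z hz => ?_
  · have hz1 := hS' n h1 hz
    have hz2 : z ∈ pseudospectrum (ε + σ) A := by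
      rw [mem_pseudospectrum_iff (by linarith)]
      rw [mem_pseudospectrum_iff (add_nonneg hε (hτ0 n h1))] at hz1
      linarith
    have := hsub hz2
    rw [Metric.mem_thickening_iff_infEDist_lt, ENNReal.ofReal_toReal hr'] at this
    exact this.le
  · rw [Metric.infEDist_zero_of_mem (hS n h1 hz)]
    exact zero_le

end Pseudospectrum

/-! ### The two inclusions and Hausdorff convergence -/

section Inclusions

variable {X : Type*} [NormedAddCommGroup X] [NormedSpace ℂ X] [CompleteSpace X] [Nontrivial X]

theorem gammaFin_subset_pseudospectrum (A B : Op X) (b : ℕ) [NeZero b] {n : ℕ} (hn : 1 ≤ n)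
    {K : Finset ℤ} (hK : IsNet n K (regroup b B)) {ε η : ℝ} (hε : 0 ≤ ε) (hη : 0 ≤ η) :
    GammaFin n K ε (regroup b B) ⊆ pseudospectrum (ε + ‖A - B‖ + η) A := by
  have := nontrivial_ell (Y := X)
  have := nontrivial_pow (Y := X) (Nat.one_le_iff_ne_zero.2 (NeZero.ne b))
  intro z hz
  have h1 := recipNormInv_le_muFin hn hK.nonempty (subScalar (regroup b B) z)
  rw [recipNormInv_subScalar_regroup] at h1
  have h2 := recipNormInv_subScalar_le A B z
  have h3 : muFin n K (subScalar (regroup b B) z) ≤ ε := hz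
  rw [mem_pseudospectrum_iff (by positivity)]
  linarith

theorem pseudospectrum_subset_gammaFin (A : Op X) {B : Op X} (b : ℕ) [NeZero b]
    (hB : HasBandwidth B b) {n : ℕ} (hn : 1 ≤ n)
    {K : Finset ℤ} (hK : IsNet n K (regroup b B)) {ε η : ℝ} (hε : 0 ≤ ε) (hη : 0 ≤ η) :
    pseudospectrum ε A ⊆ GammaFin n K
      (ε + ‖A - B‖ + η + penalty n (regroup b B) + 1 / (n : ℝ)) (regroup b B) := by
  have := nontrivial_ell (Y := X)
  have := nontrivial_pow (Y := X) (Nat.one_le_iff_ne_zero.2 (NeZero.ne b))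
  intro z hz
  have h1 := muFin_subScalar_le (isTridiagonal_regroup b hB) hn hK z
  rw [recipNormInv_subScalar_regroup] at h1
  have h2 := recipNormInv_subScalar_le B A z
  rw [norm_sub_rev] at h2
  rw [mem_pseudospectrum_iff hε] at hz
  change muFin n K (subScalar (regroup b B) z) ≤ _
  linarith

/-- The widths `w n` may grow freely: regrouping does not increase the norm, and `offDiag` is at
most twice the norm, hence bounded, while the sine tends to `0`. -/
theorem tendsto_penalty_regroup {X : Type*} [NormedAddCommGroup X] [NormedSpace ℂ X]
    {A : Op X} {An : ℕ → Op X} (hδ : Tendsto (fun n => ‖A - An n‖) atTop (𝓝 0)) (w : ℕ → ℕ+) :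
    Tendsto (fun n => penalty n (regroup (w n) (An n))) atTop (𝓝 0) := by
  have hsin : Tendsto (fun n : ℕ => Real.sin (Real.pi / (2 * ((n : ℝ) + 1)))) atTop (𝓝 0) := by
    have h1 : Tendsto (fun n : ℕ => Real.pi / (2 * ((n : ℝ) + 1))) atTop (𝓝 0) := by
      refine Tendsto.const_div_atTop ?_ _
      exact Tendsto.const_mul_atTop two_pos
        (tendsto_atTop_add_const_right _ _ tendsto_natCast_atTop_atTop)
    simpa [Function.comp_def] using (Real.continuous_sin.tendsto 0).comp h1
  have hbound : Tendsto (fun n : ℕ => 2 * (2 * (‖A‖ + ‖A - An n‖)) *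
      Real.sin (Real.pi / (2 * ((n : ℝ) + 1)))) atTop (𝓝 0) := by
    simpa using ((((hδ.const_add ‖A‖).const_mul 2).const_mul 2).mul hsin)
  refine squeeze_zero (fun n => penalty_nonneg n _) (fun n => ?_) hbound
  have h0 := sin_pi_div_nonneg n
  have h1 : ‖An n‖ ≤ ‖A‖ + ‖A - An n‖ := by
    simpa using norm_sub_le A (A - An n)
  have h2 := (offDiag_le (regroup (w n) (An n))).trans
    (mul_le_mul_of_nonneg_left ((norm_regroup_le _ _).trans h1) zero_le_two)
  rw [penalty]
  gcongr

theorem hausdorffTendsto_gammaFin {A : Op X} {An : ℕ → Op X}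
    (hδ : Tendsto (fun n => ‖A - An n‖) atTop (𝓝 0)) {w : ℕ → ℕ+}
    (hw : ∀ n, 1 ≤ n → HasBandwidth (An n) (w n)) {η : ℕ → ℝ} (hη0 : ∀ n, 0 ≤ η n)
    (hη : Tendsto η atTop (𝓝 0)) {K : ℕ → Finset ℤ}
    (hK : ∀ n, 1 ≤ n → IsNet n (K n) (regroup (w n) (An n))) {ε : ℝ} (hε : 0 ≤ ε) :
    HausdorffTendsto
      (fun n => GammaFin n (K n)
        (ε + 2 * ‖A - An n‖ + 2 * η n + penalty n (regroup (w n) (An n)) + 1 / (n : ℝ))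
        (regroup (w n) (An n)))
      (pseudospectrum ε A) := by
  have := nontrivial_ell (Y := X)
  have hpen := fun n => penalty_nonneg n (regroup (w n) (An n))
  refine hausdorffTendsto_pseudospectrum hε A
    -- The threshold already contains `2δ_n + 2η_n`, and the inclusion of `Γ` in a pseudospectrum
    -- adds a third `δ_n + η_n`.
    (τ := fun n => 3 * ‖A - An n‖ + 3 * η n + penalty n (regroup (w n) (An n)) + 1 / (n : ℝ))
    (fun n _ => ?_) ?_ (fun n hn => ?_) fun n hn => ?_
  · have := hη0 n
    have := hpen n
    positivity
  · simpa using (((hδ.const_mul 3).add (hη.const_mul 3)).add (tendsto_penalty_regroup hδ w)).add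
      tendsto_one_div_atTop_nhds_zero_nat
  · refine (pseudospectrum_subset_gammaFin A (w n) (hw n hn) hn (hK n hn) hε (hη0 n)).trans ?_
    intro z hz
    refine le_trans (show muFin _ _ _ ≤ _ from hz) ?_
    have := hη0 n
    have := norm_nonneg (A - An n)
    linarith
  · have h0 : 0 ≤ ε + 2 * ‖A - An n‖ + 2 * η n + penalty n (regroup (w n) (An n)) + 1 / (n : ℝ) := by
      have := hη0 n
      have := hpen n
      positivity
    convert! gammaFin_subset_pseudospectrum A (An n) (w n) hn (hK n hn) h0 (hη0 n) using 2
    ring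

end Inclusions

end BandDom

end

open BandDom in
theorem theorem6p1 {X : Type*} [NormedAddCommGroup X] [NormedSpace ℂ X] [CompleteSpace X]
    [Nontrivial X]
    (A : Op X) (hA : A ∈ bandDominatedOps X)
    (hcomp : IsCompact (closure {a : X →L[ℂ] X | ∃ i j : ℤ, a = entry A i j}))
    (An : ℕ → Op X) (hAn : IsBandedApprox A An)
    (hδ : Tendsto (fun n => ‖A - An n‖) atTop (𝓝 0))
    (w : ℕ → ℕ+) (hw : ∀ n, 1 ≤ n → HasBandwidth (An n) (w n))
    (η : ℕ → ℝ)
    (hη : ((FiniteDimensional ℂ X ∨ IsHilbertNorm X) ∧ ∀ n, η n = 0) ∨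
      ((∀ n, 0 < η n) ∧ Tendsto η atTop (𝓝 0))) :
    (∀ n : ℕ, 1 ≤ n → ∃ K : Finset ℤ, IsNet n K (regroup (w n) (An n))) ∧
    (∀ n : ℕ, 1 ≤ n → ∀ K : Finset ℤ, IsNet n K (regroup (w n) (An n)) →
      (∀ z : ℂ, muFin n K (subScalar (regroup (w n) (An n)) z) =
        muFinMat n K (regroup (w n) (An n)) z) ∧
      ∀ ε : ℝ, 0 ≤ ε →
        GammaFin n K ε (regroup (w n) (An n)) ⊆ pseudospectrum (ε + ‖A - An n‖ + η n) A ∧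
        pseudospectrum ε A ⊆
          GammaFin n K
            (ε + ‖A - An n‖ + η n + penalty n (regroup (w n) (An n)) + 1 / (n : ℝ))
            (regroup (w n) (An n))) ∧
    ∀ K : ℕ → Finset ℤ, (∀ n, 1 ≤ n → IsNet n (K n) (regroup (w n) (An n))) →
      (∀ ε : ℝ, 0 ≤ ε →
        HausdorffTendsto
          (fun n => GammaFin n (K n)
            (ε + 2 * ‖A - An n‖ + 2 * η n + penalty n (regroup (w n) (An n)) + 1 / (n : ℝ))
            (regroup (w n) (An n)))
          (pseudospectrum ε A)) ∧
      HausdorffTendsto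
        (fun n => GammaFin n (K n)
          (penalty n (regroup (w n) (An n)) + 2 * ‖A - An n‖ + 2 * η n + 1 / (n : ℝ))
          (regroup (w n) (An n)))
        (spectrum ℂ A) := by
  have hη0 : ∀ n, 0 ≤ η n := by
    rcases hη with ⟨-, h⟩ | ⟨h, -⟩
    · exact fun n => (h n).ge
    · exact fun n => (h n).le
  have hη' : Tendsto η atTop (𝓝 0) := by
    rcases hη with ⟨-, h⟩ | ⟨-, h⟩
    · exact tendsto_const_nhds.congr fun n => (h n).symm
    · exact h
  refine ⟨fun n hn => exists_isNet_regroup hcomp hAn (w n) hn, fun n hn K hK => ⟨fun z =>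
    muFin_subScalar (isTridiagonal_regroup (w n) (hw n hn)) n K z, fun ε hε =>
    ⟨gammaFin_subset_pseudospectrum A (An n) (w n) hn hK hε (hη0 n),
      pseudospectrum_subset_gammaFin A (w n) (hw n hn) hn hK hε (hη0 n)⟩⟩, fun K hK =>
    ⟨fun ε hε => hausdorffTendsto_gammaFin hδ hw hη0 hη' hK hε, ?_⟩⟩
  have h := hausdorffTendsto_gammaFin hδ hw hη0 hη' hK le_rfl
  rw [pseudospectrum, if_pos rfl] at h
  convert! h using 3 with n
  ring
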